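/- Let $\Omega=(\mathbb R/2\pi\mathbb Z)^2$ with Lebesgue measure. Let $H$ be the space of real $L^2$ vector fields on $\Omega$ that are mean-free and (weakly) divergence-free, with norm $|u|^2=\int_\Omega|u|^2\,dx$; let $V$ be the space of $u\in H$ with weak gradient in $L^2$, with norm $\|u\|^2=\sum_{j=1,2}\int_\Omega|\partial_ju|^2\,dx$; let $\mathbb P$ be the Leray (orthogonal) projection of $L^2$ onto $H$, $A=-\mathbb P\Delta$ the Stokes operator with domain $D(A)=\{u\in H:\Delta u\in L^2\}$, $B(u,v)=\mathbb P((u\cdot\nabla)v)$, and, for real $N>0$, let $P_N$ be the projection onto the Fourier wavenumbers $|k|\le N$. Write $|\cdot|_p$ for the norm of $L^p(\Omega)$. Let $\nu>0$ and $g_1,g_2\in L^\infty(0,\infty;H)$, and set $$\mathfrak g=\max\left\{\frac{\sup_{t\ge0}|g_1(t)|}{\nu^2},\frac{\sup_{t\ge0}|g_2(t)|}{\nu^2}\right\},$$ with essential suprema. For $N>0$ the degenerate synchronization intertwinement is the system $$\partial_tv_i+\nu Av_i+B(v_i,v_i)=g_i+P_NB(v_i,v_i),\qquad v_i(0)=v_0^i\in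 V,\qquad i=1,2.\qquad(*)$$ A global strong solution of $(*)$ is a pair with $v_i\in C([0,T];V)\cap L^2(0,T;D(A))$ and $\partial_tv_i\in L^2(0,T;H)$ for all $T>0$ that satisfies the initial conditions, and satisfies the equations in $H$ for almost every $t>0$. The system is called self-synchronous (for $g_1,g_2$) if $|g_1(t)-g_2(t)|\to0$ as $t\to\infty$ implies $|v_1(t)-v_2(t)|\to0$ as $t\to\infty$ for all initial data $v_0^1,v_0^2\in V$ and the corresponding global strong solutions. **Theorem.** The degenerate synchronization intertwinement is self-synchronous for all sufficiently large $N$, i.e. there is $N_0>0$ (depending on $\nu,g_1,g_2$, but not on the initial data) such that $(*)$ is self-synchronous for every $N\ge N_0$. More precisely, let $C_L,C_S>0$ be any constants such that $$|u|_4^2\le C_L\|u\|\,|u|\quad(u\in V),\qquad |P_Mu|_\infty\le C_S(\log M)^{1/2}\|P_Mu\|\quad(u\in V,\ M\ge2).$$ Then $(*)$ is self-synchronous whenever $N>0$ satisfies $$N\ge\max\left\{\frac{9\sqrt3}{C_L},\,12\sqrt2\,C_L\right\}\mathfrak g,\qquad N\ge32\sqrt2\,C_L\left(24\left(C_L^2+C_S^2\log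 N\right)\mathfrak g^2+1\right)^{1/2}\mathfrak g,$$ where the square root of a negative number, which can occur only for $N<1$, is read as $0$. -/

import Mathlib

noncomputable section

namespace TorusNSE

open MeasureTheory Filter Topology Set

instance factTwoPiPos : Fact (0 < 2 * Real.pi) := ⟨Real.two_pi_pos⟩

/-- The torus `Ω = (ℝ / 2πℤ)²`; its `volume` is Lebesgue measure, of total mass `4π²`. -/
abbrev Torus : Type := Fin 2 → AddCircle (2 * Real.pi)

/-- The Euclidean plane, in which vector fields take their values. -/
abbrev Plane : Type := EuclideanSpace ℝ (Fin 2)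

/-- Square-integrable real vector fields on `Ω`, with `(u, v) = ∫ u · v dx` and `|u| = ‖u‖`. -/
abbrev L2 : Type := Lp Plane 2 (volume : Measure Torus)

/-- A wavenumber `k ∈ ℤ²` as a vector of the plane; `‖wave k‖ = |k|`. -/
def wave (k : Fin 2 → ℤ) : Plane := WithLp.toLp 2 (fun i => (k i : ℝ))

/-- The continuous vector field `x ↦ cos (k · x) a`. -/
def cosField (k : Fin 2 → ℤ) (a : Plane) : C(Torus, Plane) where
  toFun x := Real.cos_periodic.lift (∑ i, k i • x i) • a
  continuous_toFun := by
    have h : Continuous fun x : Torus => (∑ i, k i • x i) := by fun_prop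
    have h' : Continuous Real.cos_periodic.lift :=
      (QuotientAddGroup.isQuotientMap_mk (N := AddSubgroup.zmultiples (2 * Real.pi))).continuous_iff.2
        Real.continuous_cos
    exact (h'.comp h).smul continuous_const

/-- The continuous vector field `x ↦ sin (k · x) a`. -/
def sinField (k : Fin 2 → ℤ) (a : Plane) : C(Torus, Plane) where
  toFun x := Real.sin_periodic.lift (∑ i, k i • x i) • a
  continuous_toFun := by
    have h : Continuous fun x : Torus => (∑ i, k i • x i) := by fun_prop
    have h' : Continuous Real.sin_periodic.lift :=
      (QuotientAddGroup.isQuotientMap_mk (N := AddSubgroup.zmultiples (2 * Real.pi))).continuous_iff.2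
        Real.continuous_sin
    exact (h'.comp h).smul continuous_const

/-- `cos (k · x) a` as an element of `L²`. -/
def cosMode (k : Fin 2 → ℤ) (a : Plane) : L2 :=
  ContinuousMap.toLp (E := Plane) 2 (volume : Measure Torus) ℝ (cosField k a)

/-- `sin (k · x) a` as an element of `L²`. -/
def sinMode (k : Fin 2 → ℤ) (a : Plane) : L2 :=
  ContinuousMap.toLp (E := Plane) 2 (volume : Measure Torus) ℝ (sinField k a)

/-- The space `H` of mean-free, divergence-free fields in `L²`: orthogonality to the constant
fields says that the mean vanishes, and orthogonality to the gradients
`∇ sin (k · x) = cos (k · x) k`, `-∇ cos (k · x) = sin (k · x) k` says that the distributional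
divergence vanishes (trigonometric polynomials are dense in the smooth functions on the torus). -/
def H : Submodule ℝ L2 :=
  (Submodule.span ℝ
    ({f | ∃ a : Plane, f = cosMode 0 a} ∪
      {f | ∃ k : Fin 2 → ℤ, f = cosMode k (wave k) ∨ f = sinMode k (wave k)}))ᗮ

instance completeSpaceH : CompleteSpace H := by unfold H; infer_instance

/-- The Leray projection, i.e. the orthogonal projection of `L²` onto `H`. -/
def leray : L2 →L[ℝ] L2 := H.starProjection

/-- The fields in `L²` whose Fourier modes with `|k| > N` all vanish. -/
def lowModes (N : ℝ) : Submodule ℝ L2 :=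
  (Submodule.span ℝ
    {f | ∃ (k : Fin 2 → ℤ) (a : Plane),
      N < ‖wave k‖ ∧ (f = cosMode k a ∨ f = sinMode k a)})ᗮ

instance completeSpaceLowModes (N : ℝ) : CompleteSpace (lowModes N) := by unfold lowModes; infer_instance

/-- `P_N`, the orthogonal projection onto the Fourier wavenumbers `|k| ≤ N`. -/
def proj (N : ℝ) : L2 →L[ℝ] L2 := (lowModes N).starProjection

/-- `w` is the weak derivative `∂_j u`, tested against the trigonometric fields:
`(w, φ) = -(u, ∂_j φ)` for `φ = cos (k · x) a` and `φ = sin (k · x) a`. -/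
def IsWeakPartial (j : Fin 2) (u w : L2) : Prop :=
  ∀ (k : Fin 2 → ℤ) (a : Plane),
    inner ℝ w (cosMode k a) = (k j : ℝ) * inner ℝ u (sinMode k a) ∧
    inner ℝ w (sinMode k a) = -((k j : ℝ) * inner ℝ u (cosMode k a))

/-- `w` is the weak Laplacian `Δu`, tested against the trigonometric fields:
`(w, φ) = (u, Δφ) = -|k|² (u, φ)`. -/
def IsWeakLaplacian (u w : L2) : Prop :=
  ∀ (k : Fin 2 → ℤ) (a : Plane),
    inner ℝ w (cosMode k a) = -(‖wave k‖ ^ 2 * inner ℝ u (cosMode k a)) ∧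
    inner ℝ w (sinMode k a) = -(‖wave k‖ ^ 2 * inner ℝ u (sinMode k a))

/-- The (unique) weak derivative `∂_j u ∈ L²`; the value is `0` if there is none. -/
def weakPartial (j : Fin 2) (u : L2) : L2 :=
  open Classical in if h : ∃ w, IsWeakPartial j u w then h.choose else 0

/-- The (unique) weak Laplacian `Δu ∈ L²`; the value is `0` if there is none. -/
def weakLaplacian (u : L2) : L2 :=
  open Classical in if h : ∃ w, IsWeakLaplacian u w then h.choose else 0

/-- The space `V`: fields of `H` with weak gradient in `L²`. -/
def V : Set L2 := {u | u ∈ H ∧ ∀ j, ∃ w, IsWeakPartial j u w}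

/-- The norm of `V`, `‖u‖² = ∑_j ∫ |∂_j u|² dx`. -/
def vNorm (u : L2) : ℝ := Real.sqrt (∑ j, ‖weakPartial j u‖ ^ 2)

/-- The domain `D(A)` of the Stokes operator: fields of `H` with weak Laplacian in `L²`. -/
def DA : Set L2 := {u | u ∈ H ∧ ∃ w, IsWeakLaplacian u w}

/-- The Stokes operator `A = -ℙΔ` (meaningful on `D(A)`). -/
def stokes (u : L2) : L2 := -leray (weakLaplacian u)

/-- The advection term `(u · ∇) v = ∑_j u_j ∂_j v`, as a function. -/
def advection (u v : L2) : Torus → Plane :=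
  fun x => ∑ j, (u x) j • (weakPartial j v) x

/-- The bilinear form `B(u, v) = ℙ((u · ∇) v)`. For `u ∈ D(A)` and `v ∈ V` the field
`(u · ∇) v` is in `L²`; where it is not, the value is `0` and is never used. -/
def bilin (u v : L2) : L2 :=
  open Classical in
  if h : MemLp (advection u v) 2 (volume : Measure Torus) then leray (h.toLp _) else 0

/-- `g ∈ L^∞(0, ∞; H)`. -/
def IsForce (g : ℝ → L2) : Prop :=
  MemLp g ⊤ (volume.restrict (Ioi (0 : ℝ))) ∧
    ∀ᵐ t ∂(volume.restrict (Ioi (0 : ℝ))), g t ∈ H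

/-- The essential supremum of `|g(t)|` over `t > 0`. -/
def supNorm (g : ℝ → L2) : ℝ := (eLpNorm g ⊤ (volume.restrict (Ioi (0 : ℝ)))).toReal

/-- Global strong solutions `v = (v₁, v₂)` of the intertwined Navier–Stokes system
`dvᵢ/dt + ν A vᵢ + B(vᵢ, vᵢ) = gᵢ + ∑ⱼ Mᵢⱼ Fⱼ(vⱼ)`, `vᵢ(0) = v₀ᵢ`:
`vᵢ ∈ C([0,T]; V) ∩ L²(0,T; D(A))`, `dvᵢ/dt ∈ L²(0,T; H)` for all `T > 0`, and the equations
hold in `H` for almost every `t > 0`. -/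
structure IsIntertwinedSolution (ν : ℝ) (M : Matrix (Fin 2) (Fin 2) ℝ) (F : Fin 2 → L2 → L2)
    (g : Fin 2 → ℝ → L2) (v₀ : Fin 2 → L2) (v : Fin 2 → ℝ → L2) : Prop where
  initial : ∀ i, v i 0 = v₀ i
  mem_V : ∀ i, ∀ t, 0 ≤ t → v i t ∈ V
  continuous : ∀ i, ContinuousOn (v i) (Ici 0)
  continuous_grad : ∀ i j, ContinuousOn (fun t => weakPartial j (v i t)) (Ici 0)
  mem_DA : ∀ i, ∀ᵐ t ∂(volume.restrict (Ioi (0 : ℝ))), v i t ∈ DA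
  memLp_stokes : ∀ i, ∀ T : ℝ, 0 < T →
    MemLp (fun t => stokes (v i t)) 2 (volume.restrict (Ioc 0 T))
  equation : ∃ dv : Fin 2 → ℝ → L2,
    (∀ i, ∀ T : ℝ, 0 < T → MemLp (dv i) 2 (volume.restrict (Ioc 0 T))) ∧
    (∀ i, ∀ t, 0 ≤ t → v i t = v₀ i + ∫ s in (0 : ℝ)..t, dv i s) ∧
    (∀ i, ∀ᵐ t ∂(volume.restrict (Ioi (0 : ℝ))),
      dv i t + ν • stokes (v i t) + bilin (v i t) (v i t) =
        g i t + ∑ j, M i j • F j (v j t))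

/-- Self-synchronization for the forces `g = (g₁, g₂)`: if `|g₁(t) - g₂(t)| → 0` as `t → ∞`
(outside a null set of times, since forces are classes in `L^∞`), then
`|v₁(t) - v₂(t)| → 0` for all initial data in `V × V`. -/
def SelfSynchronous (ν : ℝ) (M : Matrix (Fin 2) (Fin 2) ℝ) (F : Fin 2 → L2 → L2)
    (g : Fin 2 → ℝ → L2) : Prop :=
  Tendsto (fun t => ‖g 0 t - g 1 t‖) (atTop ⊓ ae volume) (𝓝 0) →
    ∀ v₀ : Fin 2 → L2, (∀ i, v₀ i ∈ V) →
      ∀ v : Fin 2 → ℝ → L2, IsIntertwinedSolution ν M F g v₀ v →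
        Tendsto (fun t => ‖v 0 t - v 1 t‖) atTop (𝓝 0)

/-- The degenerate synchronization intertwinement, `F₁(v) = F₂(v) = P_N B(v, v)` with the
identity as intertwining matrix, i.e. `∂ₜvᵢ + νAvᵢ + B(vᵢ, vᵢ) = gᵢ + P_N B(vᵢ, vᵢ)`,
is self-synchronous for the forces `g`. -/
def DegenerateSelfSynchronous (ν N : ℝ) (g : Fin 2 → ℝ → L2) : Prop :=
  SelfSynchronous ν 1 (fun _ v => proj N (bilin v v)) g

/-- `𝔤 = max {sup |g₁|, sup |g₂|} / ν²`. -/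
def grashof (ν : ℝ) (g : Fin 2 → ℝ → L2) : ℝ :=
  max (supNorm (g 0) / ν ^ 2) (supNorm (g 1) / ν ^ 2)

/-- `C` is a constant for the Ladyzhenskaya inequality `|u|₄² ≤ C ‖u‖ |u|` on `V`. -/
def IsLadyzhenskayaConst (C : ℝ) : Prop :=
  0 < C ∧ ∀ u ∈ V,
    eLpNorm u 4 (volume : Measure Torus) ^ 2 ≤ ENNReal.ofReal (C * vNorm u * ‖u‖)

/-- `C` is a constant for the borderline Sobolev inequality
`|P_N u|_∞ ≤ C (log N)^{1/2} ‖P_N u‖`, `u ∈ V`, `N ≥ 2` (no constant serves all `N > 1`,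
since `log N → 0` as `N → 1`). -/
def IsBorderlineSobolevConst (C : ℝ) : Prop :=
  0 < C ∧ ∀ N : ℝ, 2 ≤ N → ∀ u ∈ V,
    eLpNorm (proj N u) ⊤ (volume : Measure Torus) ≤
      ENNReal.ofReal (C * Real.sqrt (Real.log N) * vNorm (proj N u))

end TorusNSE

end

/-! In the modes `|k| ≤ N` the added term `P_N B(vᵢ, vᵢ)` cancels the nonlinearity, so `P_N vᵢ`
solves a damped linear Stokes equation with force `P_N gᵢ`. Hence, with `G` a bound for the forces,
`‖P_N vᵢ‖` is eventually below any `P > G / ν`, and `‖P_N (v₁ - v₂)‖ → 0` when `|g₁ - g₂| → 0`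
(`eventually_lowEnergy_le`). Only the high modes remain to be synchronized.

Let `qᵢ = vᵢ - P_N vᵢ`, `yᵢ = |qᵢ|²`, `η` the high part of `v₁ - v₂`, `z = |η|²` and `L = max N 1`.
Antisymmetry of the trilinear form (`tri_self`), Ladyzhenskaya's inequality and `|q| ≤ ‖q‖ / L` give
`yᵢ' ≤ K - (ν/2) ‖qᵢ‖²` (`energy_high_le`). For the difference, `energy_diff_le` gives decay of `z`
at rate `3νL²/4`, up to a growth term `‖v₁‖² z` and terms that contain the low difference or `g₁ -
g₂`.

The difficulty is that `‖q₁‖²` has no pointwise bound, only the time-averaged one contained in the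
inequality for `y₁`. The cure is the functional `z exp (β y₁) + εκ (y₁ + y₂)`: the dissipation in `β
y₁'` cancels the growth term `‖q₁‖² z`, and the dissipation in `εκ (y₁' + y₂')` absorbs the small
forcing that is multiplied by `‖qᵢ‖²` (`weighted_deriv_le`). What is left is a linear inequality
whose inhomogeneity is proportional to `ε`, and Gronwall's lemma concludes.

The resulting condition is `160 (Cγ)² + 512 (Cγ)⁴ < max N 1 ^ 2`, where `γ` is the number `𝔤` and
`C` any Ladyzhenskaya constant; both thresholds in the theorem follow from it. For the purely
qualitative claim a constant must exist, and `isLadyzhenskayaConst_three` supplies `C = 3`. -/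

noncomputable section

namespace TorusNSE

open MeasureTheory Filter Topology Set

/-! ### Trigonometric functions on the torus -/

/-- `x ↦ cos (k · x)` on the torus. -/
def tcos (k : Fin 2 → ℤ) : C(Torus, ℝ) where
  toFun x := Real.cos_periodic.lift (∑ i, k i • x i)
  continuous_toFun := by
    have h : Continuous fun x : Torus => (∑ i, k i • x i) := by fun_prop
    have h' : Continuous Real.cos_periodic.lift :=
      (QuotientAddGroup.isQuotientMap_mk (N := AddSubgroup.zmultiples (2 * Real.pi))).continuous_iff.2
        Real.continuous_cos
    exact h'.comp h

/-- `x ↦ sin (k · x)` on the torus. -/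
def tsin (k : Fin 2 → ℤ) : C(Torus, ℝ) where
  toFun x := Real.sin_periodic.lift (∑ i, k i • x i)
  continuous_toFun := by
    have h : Continuous fun x : Torus => (∑ i, k i • x i) := by fun_prop
    have h' : Continuous Real.sin_periodic.lift :=
      (QuotientAddGroup.isQuotientMap_mk (N := AddSubgroup.zmultiples (2 * Real.pi))).continuous_iff.2
        Real.continuous_sin
    exact h'.comp h

/-- The point of the torus with real coordinates `y`. -/
def toTorus (y : Fin 2 → ℝ) : Torus := fun i => (y i : AddCircle (2 * Real.pi))

theorem exists_toTorus (x : Torus) : ∃ y, x = toTorus y := by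
  choose y hy using fun i => QuotientAddGroup.mk_surjective (x i)
  exact ⟨y, funext fun i => (hy i).symm⟩

theorem sum_smul_toTorus (k : Fin 2 → ℤ) (y : Fin 2 → ℝ) :
    ∑ i, k i • toTorus y i = ((∑ i, k i * y i : ℝ) : AddCircle (2 * Real.pi)) := by
  simp only [toTorus, Fin.sum_univ_two, ← zsmul_eq_mul]
  rfl

theorem tcos_toTorus (k : Fin 2 → ℤ) (y : Fin 2 → ℝ) :
    tcos k (toTorus y) = Real.cos (∑ i, k i * y i) := by
  change Real.cos_periodic.lift (∑ i, k i • toTorus y i) = _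
  rw [sum_smul_toTorus, Function.Periodic.lift_coe]

theorem tsin_toTorus (k : Fin 2 → ℤ) (y : Fin 2 → ℝ) :
    tsin k (toTorus y) = Real.sin (∑ i, k i * y i) := by
  change Real.sin_periodic.lift (∑ i, k i • toTorus y i) = _
  rw [sum_smul_toTorus, Function.Periodic.lift_coe]

theorem cosField_apply (k : Fin 2 → ℤ) (a : Plane) (x : Torus) :
    cosField k a x = tcos k x • a := rfl

theorem sinField_apply (k : Fin 2 → ℤ) (a : Plane) (x : Torus) :
    sinField k a x = tsin k x • a := rfl

theorem tcos_neg (k : Fin 2 → ℤ) : tcos (-k) = tcos k := by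
  ext x
  obtain ⟨y, rfl⟩ := exists_toTorus x
  simp only [tcos_toTorus, Fin.sum_univ_two, Pi.neg_apply]
  rw [← Real.cos_neg]; congr 1; push_cast; ring

theorem tsin_neg (k : Fin 2 → ℤ) : tsin (-k) = -tsin k := by
  ext x
  obtain ⟨y, rfl⟩ := exists_toTorus x
  simp only [tsin_toTorus, Fin.sum_univ_two, Pi.neg_apply, ContinuousMap.neg_apply]
  rw [← Real.sin_neg]; congr 1; push_cast; ring

theorem tcos_zero : tcos 0 = 1 := by
  ext x
  obtain ⟨y, rfl⟩ := exists_toTorus x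
  simp [tcos_toTorus]

theorem tsin_zero : tsin 0 = 0 := by
  ext x
  obtain ⟨y, rfl⟩ := exists_toTorus x
  simp [tsin_toTorus]

theorem tcos_add_apply (k l : Fin 2 → ℤ) (x : Torus) :
    tcos (k + l) x = tcos k x * tcos l x - tsin k x * tsin l x := by
  obtain ⟨y, rfl⟩ := exists_toTorus x
  simp only [tcos_toTorus, tsin_toTorus]
  rw [← Real.cos_add]; congr 1
  simp only [Fin.sum_univ_two, Pi.add_apply]; push_cast; ring

theorem tsin_add_apply (k l : Fin 2 → ℤ) (x : Torus) :
    tsin (k + l) x = tsin k x * tcos l x + tcos k x * tsin l x := by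
  obtain ⟨y, rfl⟩ := exists_toTorus x
  simp only [tcos_toTorus, tsin_toTorus]
  rw [← Real.sin_add]; congr 1
  simp only [Fin.sum_univ_two, Pi.add_apply]; push_cast; ring

theorem tcos_sub_apply (k l : Fin 2 → ℤ) (x : Torus) :
    tcos (k - l) x = tcos k x * tcos l x + tsin k x * tsin l x := by
  rw [sub_eq_add_neg, tcos_add_apply, tcos_neg, tsin_neg, ContinuousMap.neg_apply]; ring

theorem tsin_sub_apply (k l : Fin 2 → ℤ) (x : Torus) :
    tsin (k - l) x = tsin k x * tcos l x - tcos k x * tsin l x := by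
  rw [sub_eq_add_neg, tsin_add_apply, tcos_neg, tsin_neg, ContinuousMap.neg_apply]; ring

/-- Moving by `π / k_j` along an axis with `k_j ≠ 0` shifts the phase by `π`. Translation invariance
of the measure then makes the integrals of nonconstant modes vanish. -/
theorem exists_shift (k : Fin 2 → ℤ) (hk : k ≠ 0) :
    ∃ y : Torus, (∀ x, tcos k (x + y) = -tcos k x) ∧ ∀ x, tsin k (x + y) = -tsin k x := by
  obtain ⟨j, hj⟩ := Function.ne_iff.1 hk
  have hj' : (k j : ℝ) ≠ 0 := by exact_mod_cast hj
  refine ⟨toTorus (Pi.single j (Real.pi / k j)), fun x => ?_, fun x => ?_⟩ <;>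
  · obtain ⟨y, rfl⟩ := exists_toTorus x
    have h1 : toTorus y + toTorus (Pi.single j (Real.pi / k j)) =
        toTorus (y + Pi.single j (Real.pi / k j)) := by
      ext i; simp [toTorus]
    have h2 : ∑ i, (k i : ℝ) * (y + Pi.single j (Real.pi / k j) : Fin 2 → ℝ) i =
        ∑ i, (k i : ℝ) * y i + Real.pi := by
      simp only [Pi.add_apply, mul_add, Finset.sum_add_distrib]
      congr 1
      simp [Pi.single_apply, mul_ite]
      field_simp
    rw [h1]
    first
    | rw [tcos_toTorus, tcos_toTorus, h2, Real.cos_add_pi]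
    | rw [tsin_toTorus, tsin_toTorus, h2, Real.sin_add_pi]

theorem integral_tcos (k : Fin 2 → ℤ) (hk : k ≠ 0) : ∫ x, tcos k x = 0 := by
  obtain ⟨y, hy, -⟩ := exists_shift k hk
  have := integral_add_right_eq_self (μ := (volume : Measure Torus)) (fun x => tcos k x) y
  simp only [hy, integral_neg] at this
  linarith

theorem integral_tsin (k : Fin 2 → ℤ) : ∫ x, tsin k x = 0 := by
  by_cases hk : k = 0
  · simp [hk, tsin_zero]
  obtain ⟨y, -, hy⟩ := exists_shift k hk
  have := integral_add_right_eq_self (μ := (volume : Measure Torus)) (fun x => tsin k x) y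
  simp only [hy, integral_neg] at this
  linarith

theorem integral_one_torus : ∫ _ : Torus, (1 : ℝ) = (2 * Real.pi) ^ 2 := by
  have : volume.real (univ : Set Torus) = (2 * Real.pi) ^ 2 := by
    rw [← Set.pi_univ (Set.univ : Set (Fin 2)), Measure.real, volume_pi_pi]
    simp [AddCircle.measure_univ, Real.pi_pos.le, ENNReal.toReal_ofReal]
  simp [this]

theorem integral_tcos_eq (k : Fin 2 → ℤ) :
    ∫ x, tcos k x = if k = 0 then (2 * Real.pi) ^ 2 else 0 := by
  split_ifs with h
  · simpa [h, tcos_zero] using integral_one_torus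
  · exact integral_tcos k h

theorem integrable_continuousMap (f : C(Torus, ℝ)) : Integrable f (volume : Measure Torus) := by
  exact f.continuous.integrable_of_hasCompactSupport (HasCompactSupport.of_compactSpace _)

/-! ### Density of trigonometric polynomials -/

/-- Scalar trigonometric polynomials. -/
def trigPoly : Submodule ℝ C(Torus, ℝ) := Submodule.span ℝ (range tcos ∪ range tsin)

theorem tcos_mem (k) : tcos k ∈ trigPoly := Submodule.subset_span (Or.inl ⟨k, rfl⟩)
theorem tsin_mem (k) : tsin k ∈ trigPoly := Submodule.subset_span (Or.inr ⟨k, rfl⟩)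

theorem trigPoly_mul_le : trigPoly * trigPoly ≤ trigPoly := by
  unfold trigPoly
  rw [Submodule.span_mul_span, Submodule.span_le]
  rintro _ ⟨f, hf, g, hg, rfl⟩
  change f * g ∈ trigPoly
  rcases hf with ⟨k, rfl⟩ | ⟨k, rfl⟩ <;> rcases hg with ⟨l, rfl⟩ | ⟨l, rfl⟩
  · have : tcos k * tcos l = (1 / 2 : ℝ) • (tcos (k + l) + tcos (k - l)) := by
      ext x; simp [tcos_add_apply, tcos_sub_apply]; ring
    rw [this]
    exact Submodule.smul_mem _ _ (add_mem (tcos_mem _) (tcos_mem _))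
  · have : tcos k * tsin l = (1 / 2 : ℝ) • (tsin (k + l) - tsin (k - l)) := by
      ext x; simp [tsin_add_apply, tsin_sub_apply]; ring
    rw [this]
    exact Submodule.smul_mem _ _ (sub_mem (tsin_mem _) (tsin_mem _))
  · have : tsin k * tcos l = (1 / 2 : ℝ) • (tsin (k + l) + tsin (k - l)) := by
      ext x; simp [tsin_add_apply, tsin_sub_apply]; ring
    rw [this]
    exact Submodule.smul_mem _ _ (add_mem (tsin_mem _) (tsin_mem _))
  · have : tsin k * tsin l = (1 / 2 : ℝ) • (tcos (k - l) - tcos (k + l)) := by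
      ext x; simp [tcos_add_apply, tcos_sub_apply]; ring
    rw [this]
    exact Submodule.smul_mem _ _ (sub_mem (tcos_mem _) (tcos_mem _))

/-- Stone–Weierstrass: by the product-to-sum formulas the span is already an algebra, and the cosine
and sine of one coordinate determine that coordinate modulo `2π`. -/
theorem trigPoly_dense : trigPoly.topologicalClosure = ⊤ := by
  have hle : ∀ f ∈ Algebra.adjoin ℝ (range tcos ∪ range tsin), f ∈ trigPoly := by
    intro f hf
    induction hf using Algebra.adjoin_induction with
    | mem f hf => exact Submodule.subset_span hf
    | algebraMap r =>
      have : algebraMap ℝ C(Torus, ℝ) r = r • tcos 0 := by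
        rw [tcos_zero, Algebra.algebraMap_eq_smul_one]
      rw [this]; exact Submodule.smul_mem _ _ (tcos_mem 0)
    | add f g _ _ hf hg => exact add_mem hf hg
    | mul f g _ _ hf hg => exact trigPoly_mul_le (Submodule.mul_mem_mul hf hg)
  have hsep : (Algebra.adjoin ℝ (range tcos ∪ range tsin)).SeparatesPoints := by
    intro x y hxy
    obtain ⟨i, hi⟩ := Function.ne_iff.1 hxy
    by_contra! hcon
    have hall : ∀ f ∈ range tcos ∪ range tsin, f x = f y := fun f hf =>
      hcon f ⟨f, Algebra.subset_adjoin hf, rfl⟩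
    have hc := hall (tcos (Pi.single i 1)) (Or.inl ⟨_, rfl⟩)
    have hs := hall (tsin (Pi.single i 1)) (Or.inr ⟨_, rfl⟩)
    obtain ⟨x, rfl⟩ := exists_toTorus x
    obtain ⟨y, rfl⟩ := exists_toTorus y
    rw [tcos_toTorus, tcos_toTorus] at hc
    rw [tsin_toTorus, tsin_toTorus] at hs
    simp [Pi.single_apply] at hc hs
    exact hi (Real.Angle.cos_sin_inj hc hs)
  have htop := ContinuousMap.subalgebra_topologicalClosure_eq_top_of_separatesPoints _ hsep
  rw [eq_top_iff]
  intro f _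
  have hf : f ∈ (Algebra.adjoin ℝ (range tcos ∪ range tsin)).topologicalClosure := by
    rw [htop]; trivial
  exact closure_mono hle hf

/-! ### The Hartley basis -/

/-- A continuous field as an element of `L²`. -/
abbrev fieldLp (f : C(Torus, Plane)) : L2 :=
  ContinuousMap.toLp (E := Plane) 2 (volume : Measure Torus) ℝ f

theorem inner_fieldLp (u : L2) (f : C(Torus, Plane)) :
    inner ℝ u (fieldLp f) = ∫ x, inner ℝ (u x) (f x) := by
  rw [L2.inner_def]
  refine integral_congr_ae ?_
  filter_upwards [ContinuousMap.coeFn_toLp (E := Plane) (p := 2) (𝕜 := ℝ)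
    (volume : Measure Torus) f] with x hx
  rw [hx]

theorem inner_fieldLp_fieldLp (f g : C(Torus, Plane)) :
    inner ℝ (fieldLp f) (fieldLp g) = ∫ x, inner ℝ (f x) (g x) := by
  rw [inner_fieldLp]
  refine integral_congr_ae ?_
  filter_upwards [ContinuousMap.coeFn_toLp (E := Plane) (p := 2) (𝕜 := ℝ)
    (volume : Measure Torus) f] with x hx
  rw [hx]

/-- The standard basis vectors of the plane. -/
abbrev e (i : Fin 2) : Plane := EuclideanSpace.single i 1

theorem plane_eq_sum (a : Plane) : a = ∑ i, a i • e i := by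
  ext j
  simp [Fin.sum_univ_two]
  fin_cases j <;> simp

/-- The scalar Hartley function `cas (k · x) = cos (k · x) + sin (k · x)`. -/
def cas (k : Fin 2 → ℤ) : C(Torus, ℝ) := tcos k + tsin k

/-- The field `cas (k · x) eᵢ / 2π`. -/
def hartleyField (α : (Fin 2 → ℤ) × Fin 2) : C(Torus, Plane) :=
  (2 * Real.pi)⁻¹ • (cosField α.1 (e α.2) + sinField α.1 (e α.2))

theorem hartleyField_apply (α : (Fin 2 → ℤ) × Fin 2) (x : Torus) :
    hartleyField α x = ((2 * Real.pi)⁻¹ * cas α.1 x) • e α.2 := by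
  simp only [hartleyField, ContinuousMap.smul_apply, ContinuousMap.add_apply, cosField_apply,
    sinField_apply, cas, ← add_smul, smul_smul]

theorem cas_mul_cas (k l : Fin 2 → ℤ) (x : Torus) :
    cas k x * cas l x = tcos (k - l) x + tsin (k + l) x := by
  simp only [cas, ContinuousMap.add_apply, tcos_sub_apply, tsin_add_apply]; ring

theorem integral_cas_mul_cas (k l : Fin 2 → ℤ) :
    ∫ x, cas k x * cas l x = if k = l then (2 * Real.pi) ^ 2 else 0 := by
  simp only [cas_mul_cas]
  rw [integral_add (integrable_continuousMap _) (integrable_continuousMap _), integral_tsin,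
    integral_tcos_eq, add_zero]
  simp [sub_eq_zero]

theorem inner_e (i j : Fin 2) : inner ℝ (e i) (e j) = if i = j then (1 : ℝ) else 0 := by
  simp [e, EuclideanSpace.inner_single_left]

/-- The functions `cas` give a real orthonormal system indexed by all of `ℤ²`, with no choice of a
half-plane: in `cas k * cas l = cos (k - l) + sin (k + l)` the sine always integrates to zero. -/
theorem orthonormal_hartley : Orthonormal ℝ fun α => fieldLp (hartleyField α) := by
  rw [orthonormal_iff_ite]
  rintro ⟨k, i⟩ ⟨l, j⟩
  rw [inner_fieldLp_fieldLp]
  have : ∀ x, inner ℝ (hartleyField (k, i) x) (hartleyField (l, j) x) =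
      ((2 * Real.pi)⁻¹ ^ 2 * inner ℝ (e i) (e j)) * (cas k x * cas l x) := by
    intro x
    rw [hartleyField_apply, hartleyField_apply, real_inner_smul_left, real_inner_smul_right]
    ring
  simp only [this]
  rw [integral_const_mul, integral_cas_mul_cas, inner_e]
  have := Real.pi_pos
  by_cases h1 : k = l <;> by_cases h2 : i = j <;> simp [h1, h2]
  field_simp

theorem fieldLp_hartley (k : Fin 2 → ℤ) (i : Fin 2) :
    fieldLp (hartleyField (k, i)) = (2 * Real.pi)⁻¹ • (cosMode k (e i) + sinMode k (e i)) := by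
  simp [fieldLp, hartleyField, cosMode, sinMode, map_add, map_smul]

theorem cosMode_neg (k : Fin 2 → ℤ) (a : Plane) : cosMode (-k) a = cosMode k a := by
  unfold cosMode; congr 1; ext1 x; simp [cosField_apply, tcos_neg]

theorem sinMode_neg (k : Fin 2 → ℤ) (a : Plane) : sinMode (-k) a = -sinMode k a := by
  unfold sinMode
  rw [← map_neg]; congr 1; ext1 x; simp [sinField_apply, tsin_neg]

theorem cosMode_eq_sum (k : Fin 2 → ℤ) (a : Plane) :
    cosMode k a = ∑ i, a i • cosMode k (e i) := by
  unfold cosMode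
  rw [← Finset.sum_congr rfl fun i _ => map_smul _ _ _, ← map_sum]
  congr 1; ext1 x
  conv_lhs => rw [cosField_apply, plane_eq_sum a]
  simp [cosField_apply, smul_smul, mul_comm]

theorem sinMode_eq_sum (k : Fin 2 → ℤ) (a : Plane) :
    sinMode k a = ∑ i, a i • sinMode k (e i) := by
  unfold sinMode
  rw [← Finset.sum_congr rfl fun i _ => map_smul _ _ _, ← map_sum]
  congr 1; ext1 x
  conv_lhs => rw [sinField_apply, plane_eq_sum a]
  simp [sinField_apply, smul_smul, mul_comm]

theorem cosMode_eq_hartley (k : Fin 2 → ℤ) (i : Fin 2) :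
    cosMode k (e i) =
      Real.pi • (fieldLp (hartleyField (k, i)) + fieldLp (hartleyField (-k, i))) := by
  have := Real.pi_pos.ne'
  rw [fieldLp_hartley, fieldLp_hartley, cosMode_neg, sinMode_neg]
  match_scalars <;> field_simp <;> norm_num

theorem sinMode_eq_hartley (k : Fin 2 → ℤ) (i : Fin 2) :
    sinMode k (e i) =
      Real.pi • (fieldLp (hartleyField (k, i)) - fieldLp (hartleyField (-k, i))) := by
  have := Real.pi_pos.ne'
  rw [fieldLp_hartley, fieldLp_hartley, cosMode_neg, sinMode_neg]
  match_scalars <;> field_simp <;> norm_num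

theorem integrable_mul_component (u : L2) (i : Fin 2) (f : C(Torus, ℝ)) :
    Integrable (fun x => f x * u x i) (volume : Measure Torus) := by
  have h := L2.integrable_inner (𝕜 := ℝ) u
    (fieldLp ⟨fun x => f x • e i, by fun_prop⟩)
  refine h.congr ?_
  filter_upwards [ContinuousMap.coeFn_toLp (E := Plane) (p := 2) (𝕜 := ℝ)
    (volume : Measure Torus) ⟨fun x => f x • e i, by fun_prop⟩] with x hx
  rw [hx]
  simp [real_inner_smul_right, EuclideanSpace.inner_single_right]

/-- A field that is orthogonal to all trigonometric fields vanishes. -/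
theorem eq_zero_of_orthogonal (u : L2) (hc : ∀ k i, inner ℝ u (cosMode k (e i)) = 0)
    (hs : ∀ k i, inner ℝ u (sinMode k (e i)) = 0) : u = 0 := by
  have hint : ∀ i, Integrable (fun x => u x i) (volume : Measure Torus) := fun i => by
    simpa using integrable_mul_component u i 1
  have key : ∀ i (f : C(Torus, ℝ)), ∫ x, f x * u x i = 0 := by
    intro i f
    -- Pairing with a component of `u` is continuous in the sup norm and kills trigonometric
    -- polynomials, hence all continuous functions; these are dense in `L²`.
    let Φ : C(Torus, ℝ) →ₗ[ℝ] ℝ :=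
      { toFun := fun f => ∫ x, f x * u x i
        map_add' := fun f g => by
          rw [← integral_add (integrable_mul_component u i f) (integrable_mul_component u i g)]
          simp [add_mul]
        map_smul' := fun c f => by
          simp [mul_assoc, integral_const_mul] }
    have hΦ : Continuous Φ := by
      refine (Φ.mkContinuous (∫ x, ‖u x i‖) fun f => ?_).continuous
      change ‖∫ x, f x * u x i‖ ≤ _
      refine (norm_integral_le_integral_norm _).trans ?_
      rw [mul_comm (∫ x, ‖u x i‖) ‖f‖, ← integral_const_mul]
      refine integral_mono_of_nonneg (.of_forall fun _ => norm_nonneg _)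
        ((hint i).norm.const_mul _) (.of_forall fun x => ?_)
      simp only [norm_mul]
      gcongr
      exact f.norm_coe_le_norm x
    have hle : trigPoly ≤ LinearMap.ker Φ := by
      refine Submodule.span_le.2 ?_
      rintro _ (⟨k, rfl⟩ | ⟨k, rfl⟩)
      · have := hc k i
        rw [cosMode, inner_fieldLp] at this
        simpa [Φ, cosField_apply, real_inner_smul_right, EuclideanSpace.inner_single_right]
          using this
      · have := hs k i
        rw [sinMode, inner_fieldLp] at this
        simpa [Φ, sinField_apply, real_inner_smul_right, EuclideanSpace.inner_single_right]
          using this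
    have hcl : IsClosed (LinearMap.ker Φ : Set C(Torus, ℝ)) := isClosed_singleton.preimage hΦ
    have h2 := Submodule.topologicalClosure_minimal _ hle hcl
    rw [trigPoly_dense] at h2
    exact h2 (x := f) trivial
  have horth : ∀ f : C(Torus, Plane), inner ℝ u (fieldLp f) = 0 := by
    intro f
    rw [inner_fieldLp]
    have h3 : ∀ i, ∫ x, f x i * u x i = 0 := fun i =>
      key i ⟨fun x => f x i, by fun_prop⟩
    have h4 : ∀ i, Integrable (fun x => f x i * u x i) (volume : Measure Torus) := fun i =>
      integrable_mul_component u i ⟨fun x => f x i, by fun_prop⟩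
    simp only [PiLp.inner_apply, Fin.sum_univ_two, RCLike.inner_apply, conj_trivial]
    rw [integral_add (h4 0) (h4 1), h3, h3, add_zero]
  have hd := ContinuousMap.toLp_denseRange (E := Plane) (p := 2) (𝕜 := ℝ)
    (μ := (volume : Measure Torus)) (by norm_num)
  exact hd.eq_zero_of_inner_left ℝ horth

/-- The Hilbert basis of `L²` formed by the fields `cas (k · x) eᵢ / 2π`. -/
def hartley : HilbertBasis ((Fin 2 → ℤ) × Fin 2) ℝ L2 :=
  HilbertBasis.mkOfOrthogonalEqBot orthonormal_hartley <| by
    rw [Submodule.eq_bot_iff]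
    intro u hu
    rw [Submodule.mem_orthogonal'] at hu
    have h : ∀ α, inner ℝ u (fieldLp (hartleyField α)) = 0 := fun α =>
      hu _ (Submodule.subset_span ⟨α, rfl⟩)
    refine eq_zero_of_orthogonal u (fun k i => ?_) fun k i => ?_
    · rw [cosMode_eq_hartley, real_inner_smul_right, inner_add_right, h, h]; simp
    · rw [sinMode_eq_hartley, real_inner_smul_right, inner_sub_right, h, h]; simp

theorem hartley_apply (α) : hartley α = fieldLp (hartleyField α) := by
  simp [hartley]

/-- Hartley coefficients of a field. -/
def coef (u : L2) (k : Fin 2 → ℤ) (i : Fin 2) : ℝ := inner ℝ (hartley (k, i)) u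

theorem coef_add (u v : L2) (k i) : coef (u + v) k i = coef u k i + coef v k i :=
  inner_add_right _ _ _
theorem coef_sub (u v : L2) (k i) : coef (u - v) k i = coef u k i - coef v k i :=
  inner_sub_right _ _ _
theorem coef_neg (u : L2) (k i) : coef (-u) k i = -coef u k i := inner_neg_right _ _
theorem coef_smul (c : ℝ) (u : L2) (k i) : coef (c • u) k i = c * coef u k i :=
  real_inner_smul_right _ _ _

theorem coef_ext {u v : L2} (h : ∀ k i, coef u k i = coef v k i) : u = v := by
  apply hartley.repr.injective
  ext ⟨k, i⟩
  rw [hartley.repr_apply_apply, hartley.repr_apply_apply]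
  exact h k i

theorem hasSum_coef_mul (u v : L2) :
    HasSum (fun α : (Fin 2 → ℤ) × Fin 2 => coef u α.1 α.2 * coef v α.1 α.2) (inner ℝ u v) := by
  simpa [coef, real_inner_comm] using hartley.hasSum_inner_mul_inner u v

theorem hasSum_coef_sq (u : L2) :
    HasSum (fun α : (Fin 2 → ℤ) × Fin 2 => coef u α.1 α.2 ^ 2) (‖u‖ ^ 2) := by
  rw [← real_inner_self_eq_norm_sq]
  simpa only [sq] using hasSum_coef_mul u u

theorem exists_coef (c : (Fin 2 → ℤ) → Fin 2 → ℝ)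
    (hc : Summable fun α : (Fin 2 → ℤ) × Fin 2 => c α.1 α.2 ^ 2) :
    ∃ u : L2, ∀ k i, coef u k i = c k i := by
  have hm : Memℓp (fun α : (Fin 2 → ℤ) × Fin 2 => c α.1 α.2) 2 := by
    apply memℓp_gen
    simpa using hc
  refine ⟨hartley.repr.symm ⟨_, hm⟩, fun k i => ?_⟩
  rw [coef, ← hartley.repr_apply_apply, LinearIsometryEquiv.apply_symm_apply]

theorem inner_cosMode (u : L2) (k : Fin 2 → ℤ) (a : Plane) :
    inner ℝ u (cosMode k a) = Real.pi * ∑ i, a i * (coef u k i + coef u (-k) i) := by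
  rw [cosMode_eq_sum, inner_sum, Finset.mul_sum]
  refine Finset.sum_congr rfl fun i _ => ?_
  rw [real_inner_smul_right, cosMode_eq_hartley, real_inner_smul_right, inner_add_right,
    ← hartley_apply, ← hartley_apply, real_inner_comm, real_inner_comm (hartley (-k, i)) u]
  simp only [coef]; ring

theorem inner_sinMode (u : L2) (k : Fin 2 → ℤ) (a : Plane) :
    inner ℝ u (sinMode k a) = Real.pi * ∑ i, a i * (coef u k i - coef u (-k) i) := by
  rw [sinMode_eq_sum, inner_sum, Finset.mul_sum]
  refine Finset.sum_congr rfl fun i _ => ?_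
  rw [real_inner_smul_right, sinMode_eq_hartley, real_inner_smul_right, inner_sub_right,
    ← hartley_apply, ← hartley_apply, real_inner_comm, real_inner_comm (hartley (-k, i)) u]
  simp only [coef]; ring

theorem e_apply (i j : Fin 2) : e i j = if j = i then (1 : ℝ) else 0 := by
  simp [e]

theorem coef_eq_inner (u : L2) (k i) :
    coef u k i = (2 * Real.pi)⁻¹ *
      (inner ℝ u (cosMode k (e i)) + inner ℝ u (sinMode k (e i))) := by
  have := Real.pi_pos.ne'
  rw [inner_cosMode, inner_sinMode]
  simp only [e_apply, ite_mul, one_mul, zero_mul, Finset.sum_ite_eq', Finset.mem_univ, if_true]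
  field_simp; ring

/-! ### Differential operators and projections in coefficients -/

/-- Differentiation turns `cas k` into a multiple of `cas (-k)`, so in Hartley coefficients it is a
multiplier combined with the reflection `k ↦ -k`. -/
theorem isWeakPartial_iff {j : Fin 2} {u w : L2} :
    IsWeakPartial j u w ↔ ∀ k i, coef w k i = -((k j : ℝ) * coef u (-k) i) := by
  have := Real.pi_pos.ne'
  constructor
  · intro h k i
    rw [coef_eq_inner, (h k _).1, (h k _).2, inner_cosMode, inner_sinMode]
    simp only [e_apply, ite_mul, one_mul, zero_mul, Finset.sum_ite_eq', Finset.mem_univ, if_true]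
    field_simp; ring
  · intro h k a
    simp only [inner_cosMode, inner_sinMode, h, neg_neg, Pi.neg_apply, Fin.sum_univ_two]
    push_cast
    constructor <;> ring

theorem norm_wave_neg (k : Fin 2 → ℤ) : ‖wave (-k)‖ = ‖wave k‖ := by
  rw [← norm_neg]; congr 1; ext i; simp [wave]

theorem isWeakLaplacian_iff {u w : L2} :
    IsWeakLaplacian u w ↔ ∀ k i, coef w k i = -(‖wave k‖ ^ 2 * coef u k i) := by
  have := Real.pi_pos.ne'
  constructor
  · intro h k i
    rw [coef_eq_inner, (h k _).1, (h k _).2, coef_eq_inner]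
    ring
  · intro h k a
    simp only [inner_cosMode, inner_sinMode, h, Fin.sum_univ_two, norm_wave_neg]
    constructor <;> ring

/-- The cosine test at `k` sees the sum of the coefficients at `k` and `-k`, the sine test their
difference; together they separate the two. -/
theorem mem_H_iff {u : L2} :
    u ∈ H ↔ (∀ i, coef u 0 i = 0) ∧ ∀ k : Fin 2 → ℤ, ∑ i, (k i : ℝ) * coef u k i = 0 := by
  have hpi := Real.pi_pos.ne'
  have h1 : u ∈ H ↔ (∀ a, inner ℝ u (cosMode 0 a) = 0) ∧
      ∀ k, inner ℝ u (cosMode k (wave k)) = 0 ∧ inner ℝ u (sinMode k (wave k)) = 0 := by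
    rw [H, Submodule.mem_orthogonal']
    constructor
    · exact fun h => ⟨fun a => h _ (Submodule.subset_span (Or.inl ⟨a, rfl⟩)), fun k =>
        ⟨h _ (Submodule.subset_span (Or.inr ⟨k, Or.inl rfl⟩)),
          h _ (Submodule.subset_span (Or.inr ⟨k, Or.inr rfl⟩))⟩⟩
    · rintro ⟨ha, hk⟩ w hw
      induction hw using Submodule.span_induction with
      | mem w hw =>
        rcases hw with ⟨a, rfl⟩ | ⟨k, rfl | rfl⟩
        · exact ha a
        · exact (hk k).1
        · exact (hk k).2
      | zero => simp
      | add x y _ _ hx hy => rw [inner_add_right, hx, hy, add_zero]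
      | smul c x _ hx => rw [real_inner_smul_right, hx, mul_zero]
  rw [h1]
  simp only [inner_cosMode, inner_sinMode, mul_eq_zero, hpi, false_or, neg_zero]
  constructor
  · rintro ⟨ha, hk⟩
    refine ⟨fun i => ?_, fun k => ?_⟩
    · have := ha (e i)
      simp only [e_apply, ite_mul, one_mul, zero_mul, Finset.sum_ite_eq', Finset.mem_univ,
        if_true] at this
      linarith
    · have h1 := (hk k).1
      have h2 := (hk k).2
      simp only [Fin.sum_univ_two, wave] at h1 h2 ⊢
      linarith
  · rintro ⟨ha, hk⟩
    refine ⟨fun a => by simp [ha], fun k => ?_⟩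
    have h1 := hk k
    have h2 := hk (-k)
    simp only [Fin.sum_univ_two, wave, Pi.neg_apply] at h1 h2 ⊢
    push_cast at h2
    constructor <;> linarith

/-- A basis field mixes only `k` and `-k`, which have equal length, so it lies entirely in `lowModes
N` or entirely in its orthogonal complement. -/
theorem coef_proj (N : ℝ) (u : L2) (k i) :
    coef (proj N u) k i = if ‖wave k‖ ≤ N then coef u k i else 0 := by
  have hsym : coef (proj N u) k i = inner ℝ (proj N (hartley (k, i))) u := by
    rw [coef, proj, ← Submodule.inner_starProjection_left_eq_right]
  rw [hsym]
  split_ifs with h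
  · have hmem : hartley (k, i) ∈ lowModes N := by
      rw [lowModes, Submodule.mem_orthogonal']
      intro w hw
      induction hw using Submodule.span_induction with
      | mem w hw =>
        obtain ⟨l, a, hl, hw⟩ := hw
        have h1 : l ≠ k := by rintro rfl; linarith
        have h2 : -l ≠ k := by
          rintro rfl
          linarith [norm_wave_neg l]
        have hz : ∀ l', l' ≠ k → ∀ i', coef (hartley (k, i)) l' i' = 0 := by
          intro l' hl' i'
          rw [coef, orthonormal_iff_ite.1 hartley.orthonormal, if_neg]
          simp [hl']
        rcases hw with rfl | rfl
        · rw [inner_cosMode]; simp [hz l h1, hz (-l) h2]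
        · rw [inner_sinMode]; simp [hz l h1, hz (-l) h2]
      | zero => simp
      | add x y _ _ hx hy => rw [inner_add_right, hx, hy, add_zero]
      | smul c x _ hx => rw [real_inner_smul_right, hx, mul_zero]
    rw [proj, Submodule.starProjection_eq_self_iff.2 hmem, coef]
  · have hmem : hartley (k, i) ∈ (lowModes N)ᗮ := by
      apply Submodule.le_orthogonal_orthogonal
      rw [hartley_apply, fieldLp_hartley]
      refine Submodule.smul_mem _ _ (add_mem ?_ ?_)
      · exact Submodule.subset_span ⟨k, e i, not_le.1 h, Or.inl rfl⟩
      · exact Submodule.subset_span ⟨k, e i, not_le.1 h, Or.inr rfl⟩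
    rw [proj, (Submodule.starProjection_apply_eq_zero_iff _).2 hmem, inner_zero_left]

theorem weakPartial_eq {j : Fin 2} {u w : L2} (h : IsWeakPartial j u w) :
    weakPartial j u = w := by
  have hex : ∃ w, IsWeakPartial j u w := ⟨w, h⟩
  rw [weakPartial, dif_pos hex]
  exact coef_ext fun k i => by
    rw [isWeakPartial_iff.1 hex.choose_spec, isWeakPartial_iff.1 h]

theorem weakLaplacian_eq {u w : L2} (h : IsWeakLaplacian u w) : weakLaplacian u = w := by
  have hex : ∃ w, IsWeakLaplacian u w := ⟨w, h⟩
  rw [weakLaplacian, dif_pos hex]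
  exact coef_ext fun k i => by
    rw [isWeakLaplacian_iff.1 hex.choose_spec, isWeakLaplacian_iff.1 h]

theorem isWeakPartial_weakPartial {u : L2} (hu : u ∈ V) (j : Fin 2) :
    IsWeakPartial j u (weakPartial j u) := by
  obtain ⟨w, hw⟩ := hu.2 j
  rwa [weakPartial_eq hw]

theorem coef_weakPartial {u : L2} (hu : u ∈ V) (j : Fin 2) (k i) :
    coef (weakPartial j u) k i = -((k j : ℝ) * coef u (-k) i) :=
  isWeakPartial_iff.1 (isWeakPartial_weakPartial hu j) k i

theorem norm_wave_sq (k : Fin 2 → ℤ) : ‖wave k‖ ^ 2 = ∑ j, (k j : ℝ) ^ 2 := by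
  simp [EuclideanSpace.norm_sq_eq, wave]

/-- Reflection of the wavenumber. -/
def negIdx : ((Fin 2 → ℤ) × Fin 2) ≃ ((Fin 2 → ℤ) × Fin 2) :=
  (Equiv.neg _).prodCongr (Equiv.refl _)

theorem hasSum_vNorm {u : L2} (hu : u ∈ V) :
    HasSum (fun α : (Fin 2 → ℤ) × Fin 2 => ‖wave α.1‖ ^ 2 * coef u α.1 α.2 ^ 2)
      (vNorm u ^ 2) := by
  have h1 : ∀ j, HasSum (fun α : (Fin 2 → ℤ) × Fin 2 => (α.1 j : ℝ) ^ 2 * coef u α.1 α.2 ^ 2)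
      (‖weakPartial j u‖ ^ 2) := by
    intro j
    rw [← negIdx.hasSum_iff]
    convert hasSum_coef_sq (weakPartial j u) using 1
    ext ⟨k, i⟩
    simp only [Function.comp, negIdx, Equiv.prodCongr_apply, Prod.map, Equiv.neg_apply,
      Equiv.refl_apply, coef_weakPartial hu, Pi.neg_apply]
    push_cast; ring
  have h2 := hasSum_sum (s := Finset.univ) fun j _ => h1 j
  rw [vNorm, Real.sq_sqrt (by positivity)]
  convert h2 using 1
  ext α
  rw [norm_wave_sq, Finset.sum_mul]

theorem vNorm_nonneg (u : L2) : 0 ≤ vNorm u := Real.sqrt_nonneg _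

theorem norm_weakPartial_le (j : Fin 2) (u : L2) : ‖weakPartial j u‖ ≤ vNorm u := by
  rw [vNorm]
  refine Real.le_sqrt_of_sq_le ?_
  exact Finset.single_le_sum (f := fun j => ‖weakPartial j u‖ ^ 2) (fun _ _ => by positivity)
    (Finset.mem_univ j)

/-! ### The spaces `V` and `D(A)` -/

theorem V_add {u v : L2} (hu : u ∈ V) (hv : v ∈ V) : u + v ∈ V := by
  refine ⟨add_mem hu.1 hv.1, fun j => ⟨weakPartial j u + weakPartial j v, ?_⟩⟩
  rw [isWeakPartial_iff]
  intro k i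
  rw [coef_add, coef_add, coef_weakPartial hu, coef_weakPartial hv]; ring

theorem V_smul {u : L2} (c : ℝ) (hu : u ∈ V) : c • u ∈ V := by
  refine ⟨Submodule.smul_mem _ _ hu.1, fun j => ⟨c • weakPartial j u, ?_⟩⟩
  rw [isWeakPartial_iff]
  intro k i
  rw [coef_smul, coef_smul, coef_weakPartial hu]; ring

theorem V_sub {u v : L2} (hu : u ∈ V) (hv : v ∈ V) : u - v ∈ V := by
  have := V_add hu (V_smul (-1) hv)
  rwa [neg_one_smul, ← sub_eq_add_neg] at this

theorem weakPartial_add {u v : L2} (hu : u ∈ V) (hv : v ∈ V) (j : Fin 2) :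
    weakPartial j (u + v) = weakPartial j u + weakPartial j v :=
  coef_ext fun k i => by
    rw [coef_weakPartial (V_add hu hv), coef_add, coef_add, coef_weakPartial hu,
      coef_weakPartial hv]; ring

theorem weakPartial_sub {u v : L2} (hu : u ∈ V) (hv : v ∈ V) (j : Fin 2) :
    weakPartial j (u - v) = weakPartial j u - weakPartial j v :=
  coef_ext fun k i => by
    rw [coef_weakPartial (V_sub hu hv), coef_sub, coef_sub, coef_weakPartial hu,
      coef_weakPartial hv]; ring

theorem proj_mem_H (N : ℝ) {u : L2} (hu : u ∈ H) : proj N u ∈ H := by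
  rw [mem_H_iff] at hu ⊢
  simp only [coef_proj]
  refine ⟨fun i => by simp [hu.1], fun k => ?_⟩
  split_ifs
  · exact hu.2 k
  · simp

theorem isWeakPartial_proj (N : ℝ) {j : Fin 2} {u w : L2} (h : IsWeakPartial j u w) :
    IsWeakPartial j (proj N u) (proj N w) := by
  rw [isWeakPartial_iff] at h ⊢
  intro k i
  rw [coef_proj, coef_proj, norm_wave_neg, h]
  split_ifs <;> simp

theorem proj_mem_V (N : ℝ) {u : L2} (hu : u ∈ V) : proj N u ∈ V :=
  ⟨proj_mem_H N hu.1, fun j =>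
    ⟨proj N (weakPartial j u), isWeakPartial_proj N (isWeakPartial_weakPartial hu j)⟩⟩

theorem weakPartial_proj (N : ℝ) {u : L2} (hu : u ∈ V) (j : Fin 2) :
    weakPartial j (proj N u) = proj N (weakPartial j u) :=
  weakPartial_eq (isWeakPartial_proj N (isWeakPartial_weakPartial hu j))

theorem coef_sub_proj (N : ℝ) (u : L2) (k i) :
    coef (u - proj N u) k i = if ‖wave k‖ ≤ N then 0 else coef u k i := by
  rw [coef_sub, coef_proj]; split_ifs <;> simp

theorem vNorm_sq_add (N : ℝ) {u : L2} (hu : u ∈ V) :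
    vNorm (proj N u) ^ 2 + vNorm (u - proj N u) ^ 2 = vNorm u ^ 2 := by
  have h1 := (hasSum_vNorm (proj_mem_V N hu)).add (hasSum_vNorm (V_sub hu (proj_mem_V N hu)))
  refine h1.unique ?_
  convert hasSum_vNorm hu using 1
  ext ⟨k, i⟩
  rw [coef_sub_proj, coef_proj]
  split_ifs <;> simp

theorem one_le_norm_wave {k : Fin 2 → ℤ} (hk : k ≠ 0) : 1 ≤ ‖wave k‖ := by
  obtain ⟨j, hj⟩ := Function.ne_iff.1 hk
  have h1 : (1 : ℝ) ≤ (k j : ℝ) ^ 2 := by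
    have : 1 ≤ (k j) ^ 2 := Int.add_one_le_iff.2 (sq_pos_of_ne_zero hj)
    exact_mod_cast this
  have h2 : (1 : ℝ) ^ 2 ≤ ‖wave k‖ ^ 2 := by
    rw [norm_wave_sq]
    refine (by simpa using h1 : (1 : ℝ) ^ 2 ≤ (k j : ℝ) ^ 2).trans ?_
    exact Finset.single_le_sum (f := fun j => (k j : ℝ) ^ 2) (fun _ _ => by positivity)
      (Finset.mem_univ j)
  exact le_of_sq_le_sq h2 (norm_nonneg _)

theorem poincare_of_coef {u : L2} (hu : u ∈ V) {c : ℝ} (hc : 0 ≤ c)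
    (h : ∀ k i, coef u k i ≠ 0 → c ≤ ‖wave k‖) : c * ‖u‖ ≤ vNorm u := by
  refine le_of_sq_le_sq ?_ (vNorm_nonneg u)
  rw [mul_pow]
  refine hasSum_le ?_ ((hasSum_coef_sq u).mul_left (c ^ 2)) (hasSum_vNorm hu)
  rintro ⟨k, i⟩
  by_cases h0 : coef u k i = 0
  · simp [h0]
  · have := h k i h0
    simp only
    gcongr

theorem poincare {u : L2} (hu : u ∈ V) : ‖u‖ ≤ vNorm u := by
  have := poincare_of_coef hu zero_le_one fun k i h0 =>
    one_le_norm_wave (k := k) (by rintro rfl; exact h0 ((mem_H_iff.1 hu.1).1 i))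
  simpa using this

/-- The maximum with `1` comes from the vanishing mean: nonzero wavenumbers have length at least
`1`, which keeps the constant useful for `N < 1`. -/
theorem poincare_high (N : ℝ) {u : L2} (hu : u ∈ V) :
    max N 1 * ‖u - proj N u‖ ≤ vNorm (u - proj N u) := by
  refine poincare_of_coef (V_sub hu (proj_mem_V N hu)) (by positivity) fun k i h0 => ?_
  rw [coef_sub_proj] at h0
  have h1 : ¬ ‖wave k‖ ≤ N := fun h => h0 (by simp [h])
  rw [if_neg h1] at h0
  exact max_le (not_le.1 h1).le
    (one_le_norm_wave (k := k) (by rintro rfl; exact h0 ((mem_H_iff.1 hu.1).1 i)))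

/-! ### Finiteness of the low modes and convergence of the projections -/

theorem finite_low (N : ℝ) : {α : (Fin 2 → ℤ) × Fin 2 | ‖wave α.1‖ ≤ N}.Finite := by
  have h1 : {k : Fin 2 → ℤ | ‖wave k‖ ≤ N}.Finite := by
    refine (Set.Finite.pi' (ι := Fin 2) (κ := fun _ => ℤ)
      (fun _ => Set.finite_Icc (-⌈N⌉) ⌈N⌉)).subset ?_
    intro k hk i
    have h2 : |(k i : ℝ)| ≤ N := by
      refine le_trans ?_ hk
      simpa [wave] using PiLp.norm_apply_le (wave k) i
    have h3 := abs_le.1 (h2.trans (Int.le_ceil N))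
    exact ⟨by exact_mod_cast h3.1, by exact_mod_cast h3.2⟩
  exact (h1.prod (Set.finite_univ (α := Fin 2))).subset fun α hα => ⟨hα, trivial⟩

/-- The indices of the modes with `|k| ≤ N`. -/
def lowIdx (N : ℝ) : Finset ((Fin 2 → ℤ) × Fin 2) := (finite_low N).toFinset

theorem mem_lowIdx {N : ℝ} {α} : α ∈ lowIdx N ↔ ‖wave α.1‖ ≤ N := by
  simp [lowIdx]

theorem proj_eq_sum (N : ℝ) (u : L2) :
    proj N u = ∑ α ∈ lowIdx N, coef u α.1 α.2 • hartley α := by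
  refine coef_ext fun k i => ?_
  have h : ∀ w : L2, coef w k i = inner ℝ (hartley (k, i)) w := fun _ => rfl
  rw [coef_proj, h (∑ α ∈ lowIdx N, _), inner_sum]
  simp only [real_inner_smul_right, orthonormal_iff_ite.1 hartley.orthonormal, mul_ite, mul_one,
    mul_zero, Finset.sum_ite_eq, mem_lowIdx]

theorem tendsto_proj (u : L2) : Tendsto (fun n : ℕ => proj n u) atTop (𝓝 u) := by
  have h := hartley.hasSum_repr u
  have hm : Tendsto (fun n : ℕ => lowIdx n) atTop atTop := by
    refine tendsto_atTop_finset_of_monotone (fun m n hmn α hα => ?_) fun α => ?_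
    · rw [mem_lowIdx] at hα ⊢
      exact hα.trans (by exact_mod_cast hmn)
    · obtain ⟨n, hn⟩ := exists_nat_ge ‖wave α.1‖
      exact ⟨n, mem_lowIdx.2 hn⟩
  refine (h.comp hm).congr fun n => ?_
  rw [Function.comp, proj_eq_sum]
  refine Finset.sum_congr rfl fun α _ => ?_
  simp only [hartley.repr_apply_apply]; rfl

theorem tendsto_vNorm_sub_proj {u : L2} (hu : u ∈ V) :
    Tendsto (fun n : ℕ => vNorm (u - proj n u)) atTop (𝓝 0) := by
  have h : Tendsto (fun n : ℕ => Real.sqrt (∑ j, ‖weakPartial j u - proj n (weakPartial j u)‖ ^ 2))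
      atTop (𝓝 (Real.sqrt (∑ j : Fin 2, ‖weakPartial j u - weakPartial j u‖ ^ 2))) := by
    refine (Real.continuous_sqrt.tendsto _).comp (tendsto_finsetSum _ fun j _ => ?_)
    exact ((tendsto_const_nhds.sub (tendsto_proj _)).norm).pow 2
  simp only [sub_self, norm_zero, ne_eq, OfNat.ofNat_ne_zero, not_false_eq_true, zero_pow,
    Finset.sum_const_zero, Real.sqrt_zero] at h
  refine h.congr fun n => ?_
  simp only [vNorm, weakPartial_sub hu (proj_mem_V n hu), weakPartial_proj n hu]

/-! ### The Stokes operator -/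

/-- The Laplacian is diagonal and preserves `H`, so the Leray projection in the Stokes operator acts
as the identity here. -/
theorem coef_stokes {u : L2} (hu : u ∈ DA) (k i) :
    coef (stokes u) k i = ‖wave k‖ ^ 2 * coef u k i := by
  obtain ⟨huH, w, hw⟩ := hu
  have hc := isWeakLaplacian_iff.1 hw
  have hwH : w ∈ H := by
    rw [mem_H_iff] at huH ⊢
    refine ⟨fun i => by rw [hc, huH.1]; simp, fun k => ?_⟩
    have := huH.2 k
    simp only [hc, Fin.sum_univ_two] at this ⊢
    linear_combination -(‖wave k‖ ^ 2) * this
  rw [stokes, weakLaplacian_eq hw, leray, Submodule.starProjection_eq_self_iff.2 hwH, coef_neg,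
    hc, neg_neg]

theorem inner_stokes_high (N : ℝ) {u : L2} (hu : u ∈ DA) (huV : u ∈ V) :
    inner ℝ (stokes u) (u - proj N u) = vNorm (u - proj N u) ^ 2 := by
  refine (hasSum_coef_mul (stokes u) (u - proj N u)).unique ?_
  convert hasSum_vNorm (V_sub huV (proj_mem_V N huV)) using 1
  ext ⟨k, i⟩
  rw [coef_stokes hu, coef_sub_proj]
  split_ifs <;> simp; ring

/-- This puts `∂_j u` in `L⁴`, which makes the advection term square-integrable. The second
derivatives exist because `k_l² k_j² ≤ |k|⁴` compares their coefficients with those of `stokes u`.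
-/
theorem weakPartial_mem_V {u : L2} (hu : u ∈ DA) (huV : u ∈ V) (j : Fin 2) :
    weakPartial j u ∈ V := by
  constructor
  · rw [mem_H_iff]
    refine ⟨fun i => by rw [coef_weakPartial huV]; simp, fun k => ?_⟩
    have := (mem_H_iff.1 huV.1).2 (-k)
    simp only [coef_weakPartial huV, Fin.sum_univ_two, Pi.neg_apply] at this ⊢
    push_cast at this
    linear_combination (k j : ℝ) * this
  · intro l
    have hs : Summable fun α : (Fin 2 → ℤ) × Fin 2 =>
        (-((α.1 l : ℝ) * -(((-α.1) j : ℤ) * coef u (- -α.1) α.2))) ^ 2 := by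
      refine Summable.of_nonneg_of_le (fun _ => by positivity) ?_ (hasSum_coef_sq (stokes u)).summable
      rintro ⟨k, i⟩
      have h : ∀ j, (k j : ℝ) ^ 2 ≤ ‖wave k‖ ^ 2 := fun j => by
        rw [norm_wave_sq]
        exact Finset.single_le_sum (f := fun j => (k j : ℝ) ^ 2) (fun _ _ => by positivity)
          (Finset.mem_univ j)
      simp only [neg_neg, coef_stokes hu, Pi.neg_apply]
      push_cast
      calc (-((k l : ℝ) * -(-(k j : ℝ) * coef u k i))) ^ 2
          = (k l : ℝ) ^ 2 * (k j : ℝ) ^ 2 * coef u k i ^ 2 := by ring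
        _ ≤ ‖wave k‖ ^ 2 * ‖wave k‖ ^ 2 * coef u k i ^ 2 := by
            refine mul_le_mul_of_nonneg_right ?_ (sq_nonneg _)
            exact mul_le_mul (h l) (h j) (sq_nonneg _) (sq_nonneg _)
        _ = _ := by ring
    obtain ⟨w, hw⟩ := exists_coef
      (fun k i => -((k l : ℝ) * -(((-k) j : ℤ) * coef u (- -k) i))) hs
    refine ⟨w, isWeakPartial_iff.2 fun k i => ?_⟩
    rw [hw, coef_weakPartial huV]

/-! ### The trilinear form -/

instance holderTriple_four_four_two : ENNReal.HolderTriple 4 4 2 where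
  inv_add_inv_eq_inv := by
    have h : (2 : ENNReal) * 4⁻¹ = 2⁻¹ := by
      rw [show (4 : ENNReal) = 2 * 2 by norm_num, ENNReal.mul_inv (by simp) (by simp), ← mul_assoc,
        ENNReal.mul_inv_cancel (by simp) (by simp), one_mul]
    rw [← two_mul, h]

/-- The norm of `L⁴`. -/
def norm4 (u : L2) : ℝ := (eLpNorm u 4 (volume : Measure Torus)).toReal

theorem norm4_nonneg (u : L2) : 0 ≤ norm4 u := ENNReal.toReal_nonneg

theorem IsLadyzhenskayaConst.memLp {C : ℝ} (hC : IsLadyzhenskayaConst C) {u : L2} (hu : u ∈ V) :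
    MemLp u 4 (volume : Measure Torus) := by
  refine ⟨Lp.aestronglyMeasurable u, ?_⟩
  have := (hC.2 u hu).trans_lt ENNReal.ofReal_lt_top
  exact (ENNReal.pow_lt_top_iff.1 this).resolve_right (by norm_num)

theorem IsLadyzhenskayaConst.norm4_sq_le {C : ℝ} (hC : IsLadyzhenskayaConst C) {u : L2}
    (hu : u ∈ V) : norm4 u ^ 2 ≤ C * vNorm u * ‖u‖ := by
  have h := ENNReal.toReal_mono ENNReal.ofReal_ne_top (hC.2 u hu)
  rwa [ENNReal.toReal_pow, ENNReal.toReal_ofReal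
    (mul_nonneg (mul_nonneg hC.1.le (vNorm_nonneg u)) (norm_nonneg u))] at h

theorem memLp_component {p : ENNReal} {u : Torus → Plane} (hu : MemLp u p (volume : Measure Torus))
    (j : Fin 2) : MemLp (fun x => u x j) p (volume : Measure Torus) :=
  hu.continuousLinearMap_comp (EuclideanSpace.proj (𝕜 := ℝ) j)

theorem memLp_component_smul {u w : Torus → Plane} (hu : MemLp u 4 (volume : Measure Torus))
    (hw : MemLp w 4 (volume : Measure Torus)) (j : Fin 2) :
    MemLp (fun x => u x j • w x) 2 (volume : Measure Torus) :=
  hw.smul (memLp_component hu j)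

/-- The field `u_j w` in `L²`, for `u` and `w` in `L⁴`. -/
def prodField (j : Fin 2) (u w : L2) : L2 :=
  open Classical in
  if h : MemLp (fun x => u x j • w x) 2 (volume : Measure Torus) then h.toLp _ else 0

theorem coeFn_prodField {u w : L2} (hu : MemLp u 4 (volume : Measure Torus))
    (hw : MemLp w 4 (volume : Measure Torus)) (j : Fin 2) :
    prodField j u w =ᵐ[volume] fun x => u x j • w x := by
  rw [prodField, dif_pos (memLp_component_smul hu hw j)]
  exact MemLp.coeFn_toLp _

theorem norm_prodField_le {u w : L2} (hu : MemLp u 4 (volume : Measure Torus))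
    (hw : MemLp w 4 (volume : Measure Torus)) (j : Fin 2) :
    ‖prodField j u w‖ ≤ norm4 u * norm4 w := by
  rw [prodField, dif_pos (memLp_component_smul hu hw j), Lp.norm_toLp, norm4, norm4,
    ← ENNReal.toReal_mul]
  refine ENNReal.toReal_mono (ENNReal.mul_ne_top hu.2.ne hw.2.ne) ?_
  refine (eLpNorm_smul_le_mul_eLpNorm (p := 4) (q := 4) hw.1 (memLp_component hu j).1).trans ?_
  gcongr
  exact eLpNorm_mono fun x => PiLp.norm_apply_le (u x) j

theorem prodField_add_left {u u' w : L2} (hu : MemLp u 4 (volume : Measure Torus))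
    (hu' : MemLp u' 4 (volume : Measure Torus))
    (hw : MemLp w 4 (volume : Measure Torus)) (j : Fin 2) :
    prodField j (u + u') w = prodField j u w + prodField j u' w := by
  have h : MemLp (u + u' : L2) 4 (volume : Measure Torus) :=
    (memLp_congr_ae (Lp.coeFn_add u u')).2 (hu.add hu')
  apply Lp.ext
  filter_upwards [coeFn_prodField h hw j, coeFn_prodField hu hw j, coeFn_prodField hu' hw j,
    Lp.coeFn_add u u', Lp.coeFn_add (prodField j u w) (prodField j u' w)] with x h1 h2 h3 h4 h5
  rw [h1, h5, h4, Pi.add_apply, Pi.add_apply, h2, h3, PiLp.add_apply, add_smul]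

theorem prodField_add_right {u w w' : L2} (hu : MemLp u 4 (volume : Measure Torus))
    (hw : MemLp w 4 (volume : Measure Torus))
    (hw' : MemLp w' 4 (volume : Measure Torus)) (j : Fin 2) :
    prodField j u (w + w') = prodField j u w + prodField j u w' := by
  have h : MemLp (w + w' : L2) 4 (volume : Measure Torus) :=
    (memLp_congr_ae (Lp.coeFn_add w w')).2 (hw.add hw')
  apply Lp.ext
  filter_upwards [coeFn_prodField hu h j, coeFn_prodField hu hw j, coeFn_prodField hu hw' j,
    Lp.coeFn_add w w', Lp.coeFn_add (prodField j u w) (prodField j u w')] with x h1 h2 h3 h4 h5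
  rw [h1, h5, h4, Pi.add_apply, Pi.add_apply, h2, h3, smul_add]

/-- The trilinear form `b(u, v, w) = ∫ (u · ∇) v · w dx`. -/
def tri (u v w : L2) : ℝ := ∑ j, inner ℝ (weakPartial j v) (prodField j u w)

theorem tri_le {C : ℝ} (hC : IsLadyzhenskayaConst C) {u w : L2} (hu : u ∈ V) (hw : w ∈ V)
    (v : L2) : |tri u v w| ≤ 2 * (norm4 u * norm4 w) * vNorm v := by
  have h : ∀ j, |inner ℝ (weakPartial j v) (prodField j u w)| ≤
      vNorm v * (norm4 u * norm4 w) := fun j =>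
    (abs_real_inner_le_norm _ _).trans (mul_le_mul (norm_weakPartial_le j v)
      (norm_prodField_le (hC.memLp hu) (hC.memLp hw) j) (norm_nonneg _) (vNorm_nonneg v))
  rw [tri, Fin.sum_univ_two]
  refine (abs_add_le _ _).trans ?_
  linarith [h 0, h 1]

theorem tri_add_left {C : ℝ} (hC : IsLadyzhenskayaConst C) {u u' w : L2} (hu : u ∈ V)
    (hu' : u' ∈ V) (hw : w ∈ V) (v : L2) : tri (u + u') v w = tri u v w + tri u' v w := by
  simp only [tri, prodField_add_left (hC.memLp hu) (hC.memLp hu') (hC.memLp hw),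
    inner_add_right, Finset.sum_add_distrib]

theorem tri_add_mid {v v' : L2} (hv : v ∈ V) (hv' : v' ∈ V) (u w : L2) :
    tri u (v + v') w = tri u v w + tri u v' w := by
  simp only [tri, weakPartial_add hv hv', inner_add_left, Finset.sum_add_distrib]

/-- Ladyzhenskaya's inequality for both fields, with `|u| ≤ ‖u‖` and `|w| ≤ ‖w‖`. -/
theorem norm4_mul_le {C : ℝ} (hC : IsLadyzhenskayaConst C) {u w : L2} (hu : u ∈ V)
    (hw : w ∈ V) : norm4 u * norm4 w ≤ C * vNorm u * vNorm w := by
  have h1 := hC.norm4_sq_le hu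
  have h2 := hC.norm4_sq_le hw
  have := norm4_nonneg u
  have := norm4_nonneg w
  have := vNorm_nonneg u
  have := vNorm_nonneg w
  have hC0 := hC.1.le
  have h1' : norm4 u ^ 2 ≤ C * vNorm u ^ 2 := h1.trans (by
    rw [sq, ← mul_assoc]; exact mul_le_mul_of_nonneg_left (poincare hu) (by positivity))
  have h2' : norm4 w ^ 2 ≤ C * vNorm w ^ 2 := h2.trans (by
    rw [sq, ← mul_assoc]; exact mul_le_mul_of_nonneg_left (poincare hw) (by positivity))
  refine le_of_sq_le_sq ?_ (by positivity)
  calc (norm4 u * norm4 w) ^ 2 = norm4 u ^ 2 * norm4 w ^ 2 := by ring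
    _ ≤ (C * vNorm u ^ 2) * (C * vNorm w ^ 2) := by gcongr
    _ = _ := by ring

/-! ### Antisymmetry -/

theorem memLp_fieldLp (f : C(Torus, Plane)) : MemLp (fieldLp f) 4 (volume : Measure Torus) := by
  rw [memLp_congr_ae (ContinuousMap.coeFn_toLp (E := Plane) (p := 2) (𝕜 := ℝ)
    (volume : Measure Torus) f)]
  exact f.continuous.memLp_of_hasCompactSupport (HasCompactSupport.of_compactSpace _)

theorem memLp_hartley (α) : MemLp (hartley α) 4 (volume : Measure Torus) := by
  rw [hartley_apply]; exact memLp_fieldLp _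

/-- The derivative `∂_j` of the basis field `hartley α`. -/
def hartleyPartial (j : Fin 2) (α : (Fin 2 → ℤ) × Fin 2) : L2 := (α.1 j : ℝ) • hartley (-α.1, α.2)

theorem coef_hartley (α : (Fin 2 → ℤ) × Fin 2) (k i) :
    coef (hartley α) k i = if (k, i) = α then 1 else 0 :=
  orthonormal_iff_ite.1 hartley.orthonormal _ _

theorem weakPartial_hartley (j : Fin 2) (α : (Fin 2 → ℤ) × Fin 2) :
    IsWeakPartial j (hartley α) (hartleyPartial j α) := by
  obtain ⟨l, m⟩ := α
  rw [isWeakPartial_iff]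
  intro k i
  rw [hartleyPartial, coef_smul, coef_hartley, coef_hartley]
  by_cases h : k = -l
  · subst h; by_cases h' : i = m <;> simp [h']
  · have : -k ≠ l := fun h' => h (by rw [← h', neg_neg])
    simp [h, this]

theorem coeFn_hartley (α) : hartley α =ᵐ[(volume : Measure Torus)] hartleyField α := by
  rw [hartley_apply]
  exact ContinuousMap.coeFn_toLp (E := Plane) (p := 2) (𝕜 := ℝ) (volume : Measure Torus) _

theorem cas_neg_mul_cas (k l : Fin 2 → ℤ) (x : Torus) :
    cas (-k) x * cas l x = tcos (k + l) x - tsin (k - l) x := by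
  simp only [cas, ContinuousMap.add_apply, tcos_neg, tsin_neg, ContinuousMap.neg_apply,
    tcos_add_apply, tsin_sub_apply]; ring

/-- The product formula for `cas (-k) * cas l` reduces the triple integral to pairings of `u` with
single modes, where its divergence can be tested. -/
theorem inner_hartleyPartial_prodField (u : L2) (hu : MemLp u 4 (volume : Measure Torus))
    (j : Fin 2) (k l : Fin 2 → ℤ) (i m : Fin 2) :
    inner ℝ (hartleyPartial j (k, i)) (prodField j u (hartley (l, m))) =
      ((2 * Real.pi)⁻¹ ^ 2 * inner ℝ (e i) (e m) * k j) *
        (inner ℝ u (cosMode (k + l) (e j)) - inner ℝ u (sinMode (k - l) (e j))) := by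
  have hc : inner ℝ u (cosMode (k + l) (e j)) = ∫ x, tcos (k + l) x * u x j := by
    rw [cosMode, inner_fieldLp]
    simp [cosField_apply, real_inner_smul_right, EuclideanSpace.inner_single_right]
  have hs : inner ℝ u (sinMode (k - l) (e j)) = ∫ x, tsin (k - l) x * u x j := by
    rw [sinMode, inner_fieldLp]
    simp [sinField_apply, real_inner_smul_right, EuclideanSpace.inner_single_right]
  rw [hartleyPartial, real_inner_smul_left, L2.inner_def, hc, hs,
    ← integral_sub (integrable_mul_component u j _) (integrable_mul_component u j _),
    ← integral_const_mul, ← integral_const_mul]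
  refine integral_congr_ae ?_
  filter_upwards [coeFn_hartley (-k, i), coeFn_hartley (l, m),
    coeFn_prodField hu (memLp_hartley (l, m)) j] with x h1 h2 h3
  rw [h1, h3, h2, hartleyField_apply, hartleyField_apply]
  simp only [real_inner_smul_left, real_inner_smul_right]
  linear_combination (k j : ℝ) * (2 * Real.pi)⁻¹ ^ 2 * u x j * inner ℝ (e i) (e m) *
    cas_neg_mul_cas k l x

/-- Incompressibility of `u`, tested against a product of basis functions. -/
theorem hartley_antisymm {u : L2} (huH : u ∈ H) (hu : MemLp u 4 (volume : Measure Torus))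
    (α β : (Fin 2 → ℤ) × Fin 2) :
    ∑ j, (inner ℝ (hartleyPartial j α) (prodField j u (hartley β)) +
      inner ℝ (hartleyPartial j β) (prodField j u (hartley α))) = 0 := by
  obtain ⟨k, i⟩ := α
  obtain ⟨l, m⟩ := β
  have h1 : ∀ k : Fin 2 → ℤ, ∑ j, (k j : ℝ) * inner ℝ u (cosMode k (e j)) = 0 := fun k => by
    have := (Submodule.mem_orthogonal' _ _).1 huH _
      (Submodule.subset_span (Or.inr ⟨k, Or.inl rfl⟩))
    rw [cosMode_eq_sum, inner_sum] at this
    simpa [real_inner_smul_right, wave] using this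
  have h2 : ∀ k : Fin 2 → ℤ, ∑ j, (k j : ℝ) * inner ℝ u (sinMode k (e j)) = 0 := fun k => by
    have := (Submodule.mem_orthogonal' _ _).1 huH _
      (Submodule.subset_span (Or.inr ⟨k, Or.inr rfl⟩))
    rw [sinMode_eq_sum, inner_sum] at this
    simpa [real_inner_smul_right, wave] using this
  -- In the symmetrized sum the cosine mode carries the factor `k + l` and the sine mode the factor
  -- `k - l`, exactly those of the divergence at these two wavenumbers.
  have hc := h1 (k + l)
  have hs := h2 (k - l)
  have hsin : ∀ j, inner ℝ u (sinMode (l - k) (e j)) = -inner ℝ u (sinMode (k - l) (e j)) :=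
    fun j => by rw [← neg_sub k l, sinMode_neg, inner_neg_right]
  simp only [inner_hartleyPartial_prodField u hu, real_inner_comm (e i) (e m), add_comm l k, hsin,
    Fin.sum_univ_two, Pi.add_apply, Pi.sub_apply] at hc hs ⊢
  push_cast at hc hs
  linear_combination ((2 * Real.pi)⁻¹ ^ 2 * inner ℝ (e i) (e m)) * (hc - hs)

theorem prodField_smul_right {u w : L2} (c : ℝ) (hu : MemLp u 4 (volume : Measure Torus))
    (hw : MemLp w 4 (volume : Measure Torus)) (j : Fin 2) :
    prodField j u (c • w) = c • prodField j u w := by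
  have h : MemLp (c • w : L2) 4 (volume : Measure Torus) :=
    (memLp_congr_ae (Lp.coeFn_smul c w)).2 (hw.const_smul c)
  apply Lp.ext
  filter_upwards [coeFn_prodField hu h j, coeFn_prodField hu hw j,
    Lp.coeFn_smul c w, Lp.coeFn_smul c (prodField j u w)] with x h1 h2 h3 h4
  rw [h1, h4, h3, Pi.smul_apply, Pi.smul_apply, h2, smul_comm]

theorem memLp_sum_hartley (s : Finset ((Fin 2 → ℤ) × Fin 2)) (c : (Fin 2 → ℤ) × Fin 2 → ℝ) :
    MemLp (∑ α ∈ s, c α • hartley α : L2) 4 (volume : Measure Torus) := by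
  have : (∑ α ∈ s, c α • hartley α : L2) = fieldLp (∑ α ∈ s, c α • hartleyField α) := by
    simp [fieldLp, map_sum, hartley_apply]
  rw [this]; exact memLp_fieldLp _

theorem prodField_sum_right {u : L2} (hu : MemLp u 4 (volume : Measure Torus)) (j : Fin 2)
    (s : Finset ((Fin 2 → ℤ) × Fin 2)) (c : (Fin 2 → ℤ) × Fin 2 → ℝ) :
    prodField j u (∑ α ∈ s, c α • hartley α) = ∑ α ∈ s, c α • prodField j u (hartley α) := by
  classical
  induction s using Finset.induction_on with
  | empty =>
    have := prodField_smul_right (j := j) 0 hu (memLp_hartley 0)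
    simpa using this
  | insert α s hα ih =>
    have h1 := memLp_sum_hartley {α} c
    rw [Finset.sum_singleton] at h1
    rw [Finset.sum_insert hα, Finset.sum_insert hα,
      prodField_add_right hu h1 (memLp_sum_hartley s c),
      prodField_smul_right _ hu (memLp_hartley α), ih]

theorem weakPartial_sum_hartley (j : Fin 2) (s : Finset ((Fin 2 → ℤ) × Fin 2))
    (c : (Fin 2 → ℤ) × Fin 2 → ℝ) :
    weakPartial j (∑ α ∈ s, c α • hartley α) = ∑ α ∈ s, c α • hartleyPartial j α := by
  apply weakPartial_eq
  rw [isWeakPartial_iff]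
  intro k i
  have h : ∀ (f : (Fin 2 → ℤ) × Fin 2 → L2) k i, coef (∑ α ∈ s, c α • f α) k i =
      ∑ α ∈ s, c α * coef (f α) k i := fun f k i => by
    have h : ∀ w : L2, coef w k i = inner ℝ (hartley (k, i)) w := fun _ => rfl
    simp only [h, inner_sum, real_inner_smul_right]
  rw [h, h, Finset.mul_sum, ← Finset.sum_neg_distrib]
  refine Finset.sum_congr rfl fun α _ => ?_
  rw [isWeakPartial_iff.1 (weakPartial_hartley j α)]; ring

theorem tri_sum_hartley {u : L2} (huH : u ∈ H) (hu : MemLp u 4 (volume : Measure Torus))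
    (s : Finset ((Fin 2 → ℤ) × Fin 2)) (c : (Fin 2 → ℤ) × Fin 2 → ℝ) :
    tri u (∑ α ∈ s, c α • hartley α) (∑ α ∈ s, c α • hartley α) = 0 := by
  have h1 : tri u (∑ α ∈ s, c α • hartley α) (∑ α ∈ s, c α • hartley α) =
      ∑ α ∈ s, ∑ β ∈ s, c α * c β *
        ∑ j, inner ℝ (hartleyPartial j β) (prodField j u (hartley α)) := by
    simp only [tri, weakPartial_sum_hartley, prodField_sum_right hu, sum_inner, inner_sum,
      real_inner_smul_left, real_inner_smul_right, Finset.mul_sum]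
    rw [Finset.sum_comm]
    refine Finset.sum_congr rfl fun α _ => ?_
    rw [Finset.sum_comm]
    refine Finset.sum_congr rfl fun β _ => Finset.sum_congr rfl fun j _ => by ring
  have h2 : tri u (∑ α ∈ s, c α • hartley α) (∑ α ∈ s, c α • hartley α) =
      ∑ α ∈ s, ∑ β ∈ s, c α * c β *
        ∑ j, inner ℝ (hartleyPartial j α) (prodField j u (hartley β)) := by
    rw [h1, Finset.sum_comm]
    refine Finset.sum_congr rfl fun α _ => Finset.sum_congr rfl fun β _ => by ring
  have h3 : tri u (∑ α ∈ s, c α • hartley α) (∑ α ∈ s, c α • hartley α) +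
      tri u (∑ α ∈ s, c α • hartley α) (∑ α ∈ s, c α • hartley α) = 0 := by
    conv_lhs => arg 1; rw [h1]
    rw [h2, ← Finset.sum_add_distrib]
    refine Finset.sum_eq_zero fun α _ => ?_
    rw [← Finset.sum_add_distrib]
    refine Finset.sum_eq_zero fun β _ => ?_
    rw [← mul_add, ← Finset.sum_add_distrib, hartley_antisymm huH hu, mul_zero]
  linarith

/-- The identity holds for the finite sums `P_n v` by `tri_sum_hartley`. It passes to the limit
because the gradients converge in `L²`, while `P_n v → v` in `L⁴` by Ladyzhenskaya's inequality, so
that `u_j P_n v → u_j v` in `L²`. -/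
theorem tri_self {C : ℝ} (hC : IsLadyzhenskayaConst C) {u v : L2} (hu : u ∈ V) (hv : v ∈ V) :
    tri u v v = 0 := by
  have hlim : Tendsto (fun n : ℕ => tri u (proj n v) (proj n v)) atTop (𝓝 (tri u v v)) := by
    refine tendsto_finsetSum _ fun j _ => Tendsto.inner ?_ ?_
    · simp only [weakPartial_proj _ hv]
      exact tendsto_proj _
    · have h4 : Tendsto (fun n : ℕ => norm4 (v - proj n v)) atTop (𝓝 0) := by
        have h5 : Tendsto (fun n : ℕ => C * vNorm (v - proj n v) * ‖v - proj n v‖) atTop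
            (𝓝 (C * 0 * ‖v - v‖)) :=
          ((tendsto_vNorm_sub_proj hv).const_mul C).mul
            (tendsto_const_nhds.sub (tendsto_proj v)).norm
        rw [mul_zero, zero_mul] at h5
        have h6 := squeeze_zero (fun n => sq_nonneg _)
          (fun n : ℕ => hC.norm4_sq_le (V_sub hv (proj_mem_V n hv))) h5
        have h7 := h6.sqrt
        simpa [Real.sqrt_sq (norm4_nonneg _)] using h7
      rw [tendsto_iff_norm_sub_tendsto_zero]
      have h8 := h4.const_mul (norm4 u)
      rw [mul_zero] at h8
      refine squeeze_zero (fun _ => norm_nonneg _) (fun n => ?_) h8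
      have h9 := prodField_add_right (hC.memLp hu) (hC.memLp (V_sub hv (proj_mem_V n hv)))
        (hC.memLp (proj_mem_V n hv)) j
      rw [sub_add_cancel] at h9
      rw [h9, norm_sub_rev, add_sub_cancel_right]
      exact norm_prodField_le (hC.memLp hu) (hC.memLp (V_sub hv (proj_mem_V n hv))) j
  have h0 : ∀ n : ℕ, tri u (proj n v) (proj n v) = 0 := fun n => by
    rw [proj_eq_sum]
    exact tri_sum_hartley hu.1 (hC.memLp hu) _ fun α => coef v α.1 α.2
  simp only [h0] at hlim
  exact (tendsto_nhds_unique hlim tendsto_const_nhds)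

/-! ### The nonlinearity -/

theorem memLp_advection {C : ℝ} (hC : IsLadyzhenskayaConst C) {v : L2} (hv : v ∈ DA)
    (hvV : v ∈ V) : MemLp (advection v v) 2 (volume : Measure Torus) :=
  memLp_finsetSum _ fun j _ =>
    memLp_component_smul (hC.memLp hvV) (hC.memLp (weakPartial_mem_V hv hvV j)) j

/-- The Leray projection is self-adjoint and fixes `w ∈ H`. -/
theorem inner_bilin {C : ℝ} (hC : IsLadyzhenskayaConst C) {v w : L2} (hv : v ∈ DA)
    (hvV : v ∈ V) (hw : w ∈ V) : inner ℝ (bilin v v) w = tri v v w := by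
  have hm := memLp_advection hC hv hvV
  rw [bilin, dif_pos hm, leray, Submodule.inner_starProjection_left_eq_right,
    Submodule.starProjection_eq_self_iff.2 hw.1, tri, L2.inner_def]
  simp only [L2.inner_def]
  rw [← integral_finsetSum _ fun j _ => L2.integrable_inner _ _]
  refine integral_congr_ae ?_
  filter_upwards [hm.coeFn_toLp, coeFn_prodField (hC.memLp hvV) (hC.memLp hw) 0,
    coeFn_prodField (hC.memLp hvV) (hC.memLp hw) 1] with x h1 h2 h3
  simp only [h1, advection, Fin.sum_univ_two, h2, h3, inner_add_left, real_inner_smul_left,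
    real_inner_smul_right]

/-! ### Ladyzhenskaya's inequality -/

/-- The density that controls `|φ|²` pointwise along a circle. -/
abbrev circleDensity {X : Type*} (φ φ' : X → Plane) (x : X) : ℝ :=
  (2 * Real.pi)⁻¹ * ‖φ x‖ ^ 2 + 2 * (‖φ x‖ * ‖φ' x‖)

/-- The values of `|φ|²` at two points differ by at most `2 ∫ |φ| |φ'|`; averaging over the second
point gives the bound. -/
theorem norm_sq_le_integral_circle {φ φ' : AddCircle (2 * Real.pi) → Plane} (hφ : Continuous φ)
    (hφ' : Continuous φ')
    (hd : ∀ s : ℝ, HasDerivAt (fun s : ℝ => φ (s : AddCircle (2 * Real.pi)))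
      (φ' (s : AddCircle (2 * Real.pi))) s) (x : AddCircle (2 * Real.pi)) :
    ‖φ x‖ ^ 2 ≤ ∫ y, circleDensity φ φ' y := by
  obtain ⟨a, rfl⟩ := QuotientAddGroup.mk_surjective x
  have hpi := Real.two_pi_pos
  have hc : Continuous fun s : ℝ => φ (s : AddCircle (2 * Real.pi)) :=
    hφ.comp (AddCircle.continuous_mk' _)
  have hc' : Continuous fun s : ℝ => φ' (s : AddCircle (2 * Real.pi)) :=
    hφ'.comp (AddCircle.continuous_mk' _)
  have hn : Continuous fun s : ℝ => ‖φ (s : AddCircle (2 * Real.pi))‖ ^ 2 := hc.norm.pow 2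
  have hn' : Continuous fun s : ℝ => ‖φ (s : AddCircle (2 * Real.pi))‖ *
    ‖φ' (s : AddCircle (2 * Real.pi))‖ := hc.norm.mul hc'.norm
  set I := ∫ s in a..(a + 2 * Real.pi),
    ‖φ (s : AddCircle (2 * Real.pi))‖ * ‖φ' (s : AddCircle (2 * Real.pi))‖ with hI
  have hpt : ∀ t ∈ Icc a (a + 2 * Real.pi),
      ‖φ (a : AddCircle (2 * Real.pi))‖ ^ 2 ≤ ‖φ (t : AddCircle (2 * Real.pi))‖ ^ 2 + 2 * I := by
    intro t ht
    have hder : ∀ s ∈ uIcc a t, HasDerivAt (fun s : ℝ => ‖φ (s : AddCircle (2 * Real.pi))‖ ^ 2)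
        (2 * inner ℝ (φ (s : AddCircle (2 * Real.pi))) (φ' (s : AddCircle (2 * Real.pi)))) s :=
      fun s _ => (hd s).norm_sq
    have hftc := intervalIntegral.integral_eq_sub_of_hasDerivAt hder
      ((hc.inner hc').const_mul 2 |>.intervalIntegrable _ _)
    rw [intervalIntegral.integral_const_mul] at hftc
    have hle : |∫ s in a..t, inner ℝ (φ (s : AddCircle (2 * Real.pi)))
        (φ' (s : AddCircle (2 * Real.pi)))| ≤ I := by
      refine (intervalIntegral.abs_integral_le_integral_abs ht.1).trans ?_
      refine (intervalIntegral.integral_mono_on ht.1 ((hc.inner hc').abs.intervalIntegrable _ _)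
        (hn'.intervalIntegrable _ _)
        fun s _ => abs_real_inner_le_norm _ _).trans ?_
      exact intervalIntegral.integral_mono_interval le_rfl ht.1 ht.2
        (.of_forall fun s => mul_nonneg (norm_nonneg _) (norm_nonneg _)) (hn'.intervalIntegrable _ _)
    have := abs_le.1 hle
    linarith
  have hint := intervalIntegral.integral_mono_on (μ := volume) (by linarith)
    (continuous_const.intervalIntegrable a (a + 2 * Real.pi))
    ((hn.add (continuous_const (y := 2 * I))).intervalIntegrable a (a + 2 * Real.pi)) hpt
  simp only [Pi.add_apply] at hint
  rw [intervalIntegral.integral_const, intervalIntegral.integral_add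
    (hn.intervalIntegrable _ _) (continuous_const.intervalIntegrable _ _),
    intervalIntegral.integral_const, add_sub_cancel_left, smul_eq_mul, smul_eq_mul] at hint
  rw [← AddCircle.intervalIntegral_preimage (2 * Real.pi) a,
    intervalIntegral.integral_add ((hn.const_mul _).intervalIntegrable _ _)
      ((hn'.const_mul _).intervalIntegrable _ _),
    intervalIntegral.integral_const_mul, intervalIntegral.integral_const_mul, ← hI]
  change ‖φ (a : AddCircle (2 * Real.pi))‖ ^ 2 ≤ _
  rw [← mul_le_mul_iff_right₀ hpi]
  refine hint.trans (le_of_eq ?_)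
  field_simp

/-- `f'` is the classical derivative of `f` in the direction of the `j`-th axis. -/
def HasPartial (j : Fin 2) (f f' : C(Torus, Plane)) : Prop :=
  ∀ (x : Torus) (s : ℝ), HasDerivAt
    (fun s : ℝ => f (Function.update x j (s : AddCircle (2 * Real.pi))))
    (f' (Function.update x j (s : AddCircle (2 * Real.pi)))) s

theorem integral_torus (f : C(Torus, ℝ)) :
    ∫ x, f x = ∫ z : AddCircle (2 * Real.pi) × AddCircle (2 * Real.pi), f ![z.1, z.2] := by
  rw [← (volume_preserving_finTwoArrow (AddCircle (2 * Real.pi))).symm.integral_comp'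
    (g := fun x => f x)]
  rfl

/-- One factor `|f|²` is bounded by an integral along the first axis, a function of the second
coordinate alone, the other the opposite way; the integral of their product then factorizes. -/
theorem integral_norm_pow_four_le {f f₀ f₁ : C(Torus, Plane)} (h₀ : HasPartial 0 f f₀)
    (h₁ : HasPartial 1 f f₁) :
    ∫ x, ‖f x‖ ^ 4 ≤ (∫ x, circleDensity f f₀ x) * ∫ x, circleDensity f f₁ x := by
  have hK : ∀ g : C(Torus, Plane), Continuous (circleDensity f g) := fun g => by
    unfold circleDensity; fun_prop
  have e₄ := integral_torus ⟨fun x => ‖f x‖ ^ 4, by fun_prop⟩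
  have e₀ := integral_torus ⟨_, hK f₀⟩
  have e₁ := integral_torus ⟨_, hK f₁⟩
  simp only [ContinuousMap.coe_mk] at e₄ e₀ e₁
  rw [e₄, e₀, e₁]
  set T := AddCircle (2 * Real.pi)
  have hvec : Continuous fun z : T × T => (![z.1, z.2] : Torus) := by
    refine continuous_pi fun i => ?_
    fin_cases i <;> simp <;> fun_prop
  have hint : ∀ {g : T × T → ℝ}, Continuous g → Integrable g (volume : Measure (T × T)) :=
    fun hg => hg.integrable_of_hasCompactSupport (HasCompactSupport.of_compactSpace _)
  have hG₀ : Continuous fun b : T => ∫ a : T, circleDensity f f₀ ![a, b] := by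
    have h : Continuous (Function.uncurry fun (b a : T) => circleDensity f f₀ ![a, b]) :=
      (hK f₀).comp (hvec.comp continuous_swap)
    simpa using continuous_parametric_integral_of_continuous (μ := (volume : Measure T)) h
      isCompact_univ
  have hG₁ : Continuous fun a : T => ∫ b : T, circleDensity f f₁ ![a, b] := by
    have h : Continuous (Function.uncurry fun (a b : T) => circleDensity f f₁ ![a, b]) :=
      (hK f₁).comp hvec
    simpa using continuous_parametric_integral_of_continuous (μ := (volume : Measure T)) h
      isCompact_univ
  have hpt : ∀ z : T × T, ‖f ![z.1, z.2]‖ ^ 4 ≤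
      (∫ b : T, circleDensity f f₁ ![z.1, b]) * ∫ a : T, circleDensity f f₀ ![a, z.2] := by
    rintro ⟨a, b⟩
    have e₀ : ∀ s : T, Function.update (![a, b] : Torus) 0 s = ![s, b] := fun s => by
      ext i; fin_cases i <;> simp
    have e₁ : ∀ s : T, Function.update (![a, b] : Torus) 1 s = ![a, s] := fun s => by
      ext i; fin_cases i <;> simp
    have k₀ := norm_sq_le_integral_circle (φ := fun s => f ![s, b]) (φ' := fun s => f₀ ![s, b])
      (f.continuous.comp (hvec.comp (by fun_prop : Continuous fun s : T => (s, b))))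
      (f₀.continuous.comp (hvec.comp (by fun_prop : Continuous fun s : T => (s, b))))
      (fun s => by simpa only [e₀] using h₀ ![a, b] s) a
    have k₁ := norm_sq_le_integral_circle (φ := fun s => f ![a, s]) (φ' := fun s => f₁ ![a, s])
      (f.continuous.comp (hvec.comp (by fun_prop : Continuous fun s : T => (a, s))))
      (f₁.continuous.comp (hvec.comp (by fun_prop : Continuous fun s : T => (a, s))))
      (fun s => by simpa only [e₁] using h₁ ![a, b] s) b
    calc ‖f ![a, b]‖ ^ 4 = ‖f ![a, b]‖ ^ 2 * ‖f ![a, b]‖ ^ 2 := by ring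
      _ ≤ _ := mul_le_mul k₁ k₀ (sq_nonneg _) ((sq_nonneg _).trans k₁)
  refine (integral_mono (hint ?_) (hint ?_) hpt).trans (le_of_eq ?_)
  · exact ((f.continuous.comp hvec).norm).pow 4
  · exact (hG₁.comp continuous_fst).mul (hG₀.comp continuous_snd)
  · rw [Measure.volume_eq_prod, integral_prod_mul (fun a : T => ∫ b : T, circleDensity f f₁ ![a, b])
      (fun b : T => ∫ a : T, circleDensity f f₀ ![a, b]), mul_comm]
    congr 1
    · rw [integral_prod_symm]
      exact hint ((hK f₀).comp hvec)
    · rw [integral_prod]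
      exact hint ((hK f₁).comp hvec)

theorem norm_fieldLp_sq (f : C(Torus, Plane)) : ‖fieldLp f‖ ^ 2 = ∫ x, ‖f x‖ ^ 2 := by
  rw [← real_inner_self_eq_norm_sq, inner_fieldLp_fieldLp]
  simp only [real_inner_self_eq_norm_sq]

theorem integral_norm_mul_norm_le (f g : C(Torus, Plane)) :
    ∫ x, ‖f x‖ * ‖g x‖ ≤ ‖fieldLp f‖ * ‖fieldLp g‖ := by
  have hm : ∀ f : C(Torus, Plane), MemLp (fun x => ‖f x‖) (ENNReal.ofReal 2)
      (volume : Measure Torus) := fun f =>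
    f.continuous.norm.memLp_of_hasCompactSupport (HasCompactSupport.of_compactSpace _)
  have h := integral_mul_le_Lp_mul_Lq_of_nonneg (μ := (volume : Measure Torus))
    Real.HolderConjugate.two_two (f := fun x => ‖f x‖) (g := fun x => ‖g x‖)
    (.of_forall fun _ => norm_nonneg _) (.of_forall fun _ => norm_nonneg _) (hm f) (hm g)
  simp only [Real.rpow_two, ← norm_fieldLp_sq] at h
  rw [← Real.sqrt_eq_rpow, ← Real.sqrt_eq_rpow, Real.sqrt_sq (norm_nonneg _),
    Real.sqrt_sq (norm_nonneg _)] at h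
  exact h

theorem integral_circleDensity_le (f g : C(Torus, Plane)) :
    ∫ x, circleDensity f g x ≤
      (2 * Real.pi)⁻¹ * ‖fieldLp f‖ ^ 2 + 2 * (‖fieldLp f‖ * ‖fieldLp g‖) := by
  have h1 : Integrable (fun x => (2 * Real.pi)⁻¹ * ‖f x‖ ^ 2) (volume : Measure Torus) :=
    integrable_continuousMap ⟨fun x => (2 * Real.pi)⁻¹ * ‖f x‖ ^ 2, by fun_prop⟩
  have h2 : Integrable (fun x => 2 * (‖f x‖ * ‖g x‖)) (volume : Measure Torus) :=
    integrable_continuousMap ⟨fun x => 2 * (‖f x‖ * ‖g x‖), by fun_prop⟩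
  rw [integral_add h1 h2, integral_const_mul, integral_const_mul, norm_fieldLp_sq]
  linarith [integral_norm_mul_norm_le f g]

theorem hasDerivAt_cas (k : Fin 2 → ℤ) (j : Fin 2) (x : Torus) (s : ℝ) :
    HasDerivAt (fun s : ℝ => cas k (Function.update x j (s : AddCircle (2 * Real.pi))))
      ((k j : ℝ) * cas (-k) (Function.update x j (s : AddCircle (2 * Real.pi)))) s := by
  obtain ⟨y, rfl⟩ := exists_toTorus x
  have hu : ∀ s : ℝ, Function.update (toTorus y) j (s : AddCircle (2 * Real.pi)) =
      toTorus (Function.update y j s) := fun s => by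
    ext i
    by_cases h : i = j
    · subst h; simp [toTorus]
    · simp [toTorus, h]
  have hsum : ∀ s : ℝ, ∑ i, (k i : ℝ) * Function.update y j s i =
      (k j : ℝ) * s + ∑ i ∈ Finset.univ.erase j, (k i : ℝ) * y i := fun s => by
    rw [← Finset.add_sum_erase _ _ (Finset.mem_univ j), Function.update_self]
    congr 1
    refine Finset.sum_congr rfl fun i hi => ?_
    rw [Function.update_of_ne (Finset.ne_of_mem_erase hi)]
  simp only [hu, cas, ContinuousMap.add_apply, tcos_neg, tsin_neg, ContinuousMap.neg_apply,
    tcos_toTorus, tsin_toTorus, hsum]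
  have h : HasDerivAt (fun s : ℝ => (k j : ℝ) * s + ∑ i ∈ Finset.univ.erase j, (k i : ℝ) * y i)
      (k j : ℝ) s := by
    simpa using ((hasDerivAt_id s).const_mul (k j : ℝ)).add_const
      (∑ i ∈ Finset.univ.erase j, (k i : ℝ) * y i)
  exact (h.cos.fun_add h.sin).congr_deriv (by ring)

theorem hasPartial_sum (j : Fin 2) (s : Finset ((Fin 2 → ℤ) × Fin 2))
    (c : (Fin 2 → ℤ) × Fin 2 → ℝ) :
    HasPartial j (∑ α ∈ s, c α • hartleyField α)
      (∑ α ∈ s, c α • (α.1 j : ℝ) • hartleyField (-α.1, α.2)) := by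
  intro x t
  simp only [ContinuousMap.coe_sum, ContinuousMap.coe_smul, Finset.sum_apply, Pi.smul_apply,
    hartleyField_apply]
  refine HasDerivAt.fun_sum fun α _ => ?_
  have := (((hasDerivAt_cas α.1 j x t).const_mul (2 * Real.pi)⁻¹).smul_const (e α.2)).const_smul
    (c α)
  refine this.congr_deriv ?_
  rw [smul_smul (α.1 j : ℝ)]; congr 2; ring

/-- Projected fields are trigonometric polynomials, whose classical derivatives represent the weak
ones. The constant is `3 = 1 + 2`: the zeroth-order term costs at most `1` by `(2π)⁻¹ ≤ 1` and
Poincaré, the derivative term `2`. -/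
theorem ladyzhenskaya_proj {u : L2} (hu : u ∈ V) (N : ℝ) :
    eLpNorm (proj N u) 4 (volume : Measure Torus) ^ 2 ≤
      ENNReal.ofReal (3 * vNorm (proj N u) * ‖proj N u‖) := by
  set c : (Fin 2 → ℤ) × Fin 2 → ℝ := fun α => coef u α.1 α.2
  set f : C(Torus, Plane) := ∑ α ∈ lowIdx N, c α • hartleyField α
  have hp : proj N u = fieldLp f := by
    rw [proj_eq_sum]; simp [f, c, fieldLp, map_sum, hartley_apply]
  have hd : ∀ j, weakPartial j (proj N u) =
      fieldLp (∑ α ∈ lowIdx N, c α • (α.1 j : ℝ) • hartleyField (-α.1, α.2)) := fun j => by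
    rw [proj_eq_sum, weakPartial_sum_hartley j _ c]
    simp [fieldLp, map_sum, hartley_apply, hartleyPartial]
  have hV := proj_mem_V N hu
  have hpoin := poincare hV
  have hK : ∀ j, ∫ x, circleDensity f
      (∑ α ∈ lowIdx N, c α • (α.1 j : ℝ) • hartleyField (-α.1, α.2) : C(Torus, Plane)) x ≤
      3 * vNorm (proj N u) * ‖proj N u‖ := fun j => by
    refine (integral_circleDensity_le _ _).trans ?_
    rw [← hd, ← hp]
    have h1 := norm_weakPartial_le j (proj N u)
    have h2 : (2 * Real.pi)⁻¹ ≤ 1 := inv_le_one_of_one_le₀ (by linarith [Real.pi_gt_three])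
    have h3 : (2 * Real.pi)⁻¹ * ‖proj N u‖ ^ 2 ≤ 1 * ‖proj N u‖ ^ 2 := by gcongr
    nlinarith [norm_nonneg (proj N u), mul_le_mul_of_nonneg_left h1 (norm_nonneg (proj N u)),
      mul_le_mul_of_nonneg_left hpoin (norm_nonneg (proj N u))]
  have h4 := (integral_norm_pow_four_le (hasPartial_sum 0 (lowIdx N) c)
    (hasPartial_sum 1 (lowIdx N) c))
  have hR : 0 ≤ 3 * vNorm (proj N u) * ‖proj N u‖ := by
    have := vNorm_nonneg (proj N u); positivity
  have h5 : ∫ x, ‖f x‖ ^ 4 ≤ (3 * vNorm (proj N u) * ‖proj N u‖) ^ 2 := by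
    refine h4.trans ?_
    rw [sq]
    refine mul_le_mul (hK 0) (hK 1) (integral_nonneg fun x => ?_) hR
    unfold circleDensity
    have := Real.pi_pos
    positivity
  have h6 : eLpNorm (proj N u) 4 (volume : Measure Torus) =
      ENNReal.ofReal ((∫ x, ‖f x‖ ^ 4) ^ (4 : ℝ)⁻¹) := by
    rw [hp, eLpNorm_congr_ae (ContinuousMap.coeFn_toLp (E := Plane) (p := 2) (𝕜 := ℝ)
      (volume : Measure Torus) f), MemLp.eLpNorm_eq_integral_rpow_norm (by norm_num) (by norm_num)
      (f.continuous.memLp_of_hasCompactSupport (HasCompactSupport.of_compactSpace _))]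
    norm_num
  rw [h6, ← ENNReal.ofReal_pow (by positivity)]
  refine ENNReal.ofReal_le_ofReal ?_
  refine le_of_sq_le_sq ?_ hR
  refine le_trans (le_of_eq ?_) h5
  have h0 : 0 ≤ ∫ x, ‖f x‖ ^ 4 := by positivity
  rw [← pow_mul, ← Real.rpow_natCast, ← Real.rpow_mul h0]
  norm_num

theorem vNorm_proj_le (N : ℝ) {u : L2} (hu : u ∈ V) : vNorm (proj N u) ≤ vNorm u :=
  le_of_sq_le_sq (by nlinarith [vNorm_sq_add N hu, sq_nonneg (vNorm (u - proj N u))])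
    (vNorm_nonneg u)

theorem norm_proj_le (N : ℝ) (u : L2) : ‖proj N u‖ ≤ ‖u‖ :=
  Submodule.norm_starProjection_apply_le _ _

theorem isLadyzhenskayaConst_three : IsLadyzhenskayaConst 3 := by
  refine ⟨by norm_num, fun u hu => ?_⟩
  have hR : 0 ≤ 3 * vNorm u * ‖u‖ := by have := vNorm_nonneg u; positivity
  have h1 : eLpNorm u 4 (volume : Measure Torus) ≤
      ENNReal.ofReal (3 * vNorm u * ‖u‖) ^ (2 : ℝ)⁻¹ := by
    -- The `L⁴` norm is lower semicontinuous under convergence in measure, which `L²` convergence of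
    -- the projections provides.
    refine eLpNorm_le_of_tendstoInMeasure (u := atTop) (f := fun n : ℕ => proj n u)
      (.of_forall fun n => ?_) (tendstoInMeasure_of_tendsto_Lp (tendsto_proj u))
      fun n => Lp.aestronglyMeasurable _
    rw [ENNReal.le_rpow_inv_iff (by norm_num), ENNReal.rpow_two]
    refine (ladyzhenskaya_proj hu n).trans (ENNReal.ofReal_le_ofReal ?_)
    have := vNorm_nonneg u
    exact mul_le_mul (mul_le_mul_of_nonneg_left (vNorm_proj_le n hu) (by norm_num))
      (norm_proj_le n u) (norm_nonneg _) (by positivity)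
  rwa [ENNReal.le_rpow_inv_iff (by norm_num), ENNReal.rpow_two] at h1

/-! ### Absolutely continuous functions and Gronwall's inequality -/

section AbsolutelyContinuous

variable {X Y : Type*} [PseudoMetricSpace X] [PseudoMetricSpace Y]

/-- Common source of the closure properties below. Solutions satisfy their equations only almost
everywhere, so monotonicity arguments need absolute continuity of the energies. -/
theorem absolutelyContinuous_of_dist_le {f : ℝ → X} {g : ℝ → Y} {a b K : ℝ}
    (hg : AbsolutelyContinuousOnInterval g a b)
    (h : ∀ s ∈ uIcc a b, ∀ t ∈ uIcc a b, dist (f s) (f t) ≤ K * dist (g s) (g t)) :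
    AbsolutelyContinuousOnInterval f a b := by
  rw [absolutelyContinuousOnInterval_iff] at hg ⊢
  intro ε hε
  obtain ⟨δ, hδ, hE⟩ := hg (ε / (|K| + 1)) (by positivity)
  refine ⟨δ, hδ, fun E hEm hEd => ?_⟩
  have h1 := hE E hEm hEd
  calc ∑ i ∈ Finset.range E.1, dist (f (E.2 i).1) (f (E.2 i).2)
      ≤ ∑ i ∈ Finset.range E.1, (|K| + 1) * dist (g (E.2 i).1) (g (E.2 i).2) := by
        refine Finset.sum_le_sum fun i hi => ?_
        have hmem := hEm.1 i hi
        refine (h _ hmem.1 _ hmem.2).trans ?_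
        gcongr
        linarith [le_abs_self K]
    _ < ε := by
        rw [← Finset.mul_sum]
        rwa [lt_div_iff₀' (by positivity)] at h1

variable {E F : Type*} [NormedAddCommGroup E] [NormedSpace ℝ E]
  [NormedAddCommGroup F] [NormedSpace ℝ F]

theorem absolutelyContinuous_clm {f : ℝ → E} {a b : ℝ} (L : E →L[ℝ] F)
    (hf : AbsolutelyContinuousOnInterval f a b) :
    AbsolutelyContinuousOnInterval (fun t => L (f t)) a b :=
  absolutelyContinuous_of_dist_le (K := ‖L‖) hf fun s _ t _ => by
    rw [dist_eq_norm, dist_eq_norm, ← map_sub]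
    exact L.le_opNorm _

theorem absolutelyContinuous_norm_sq {E : Type*} [NormedAddCommGroup E] {f : ℝ → E} {a b : ℝ}
    (hf : AbsolutelyContinuousOnInterval f a b) :
    AbsolutelyContinuousOnInterval (fun t => ‖f t‖ ^ 2) a b := by
  obtain ⟨C, hC⟩ := hf.exists_bound
  refine absolutelyContinuous_of_dist_le (K := 2 * C) hf fun s hs t ht => ?_
  have h1 := hC s hs
  have h2 := hC t ht
  rw [Real.dist_eq, dist_eq_norm, sq_sub_sq, abs_mul, abs_of_nonneg (by positivity)]
  exact mul_le_mul (by linarith) (abs_norm_sub_norm_le _ _) (abs_nonneg _)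
    (by linarith [norm_nonneg (f s)])

theorem absolutelyContinuous_comp_contDiff {φ f : ℝ → ℝ} {a b : ℝ} (hφ : ContDiff ℝ 1 φ)
    (hf : AbsolutelyContinuousOnInterval f a b) :
    AbsolutelyContinuousOnInterval (fun t => φ (f t)) a b := by
  obtain ⟨C, hC⟩ := hf.exists_bound
  obtain ⟨K, hK⟩ := hφ.contDiffOn.exists_lipschitzOnWith (s := Icc (-C) C) (by decide)
    (convex_Icc _ _) isCompact_Icc
  exact absolutelyContinuous_of_dist_le (K := K) hf fun s hs t ht =>
    hK.dist_le_mul _ (abs_le.1 (hC s hs)) _ (abs_le.1 (hC t ht))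

theorem absolutelyContinuous_primitive {v dv : ℝ → E} {v₀ : E} {T : ℝ} (hT : 0 ≤ T)
    (hdv : IntervalIntegrable dv volume 0 T)
    (hv : ∀ t, 0 ≤ t → v t = v₀ + ∫ s in (0 : ℝ)..t, dv s) :
    AbsolutelyContinuousOnInterval v 0 T := by
  refine absolutelyContinuous_of_dist_le (K := 1)
    (hdv.norm.absolutelyContinuousOnInterval_intervalIntegral (c := 0) (by simp))
    fun s hs t ht => ?_
  have hsub : ∀ r ∈ uIcc 0 T, IntervalIntegrable dv volume 0 r := fun r hr =>
    hdv.mono_set (uIcc_subset_uIcc_left hr)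
  have h1 := hsub s hs
  have h2 := hsub t ht
  rw [uIcc_of_le hT] at hs ht
  rw [hv s hs.1, hv t ht.1, dist_add_left, dist_eq_norm, Real.dist_eq, one_mul,
    intervalIntegral.integral_interval_sub_left h1 h2,
    intervalIntegral.integral_interval_sub_left h1.norm h2.norm]
  exact intervalIntegral.norm_integral_le_abs_integral_norm

theorem ae_hasDerivAt_primitive [CompleteSpace E] {v dv : ℝ → E} {v₀ : E}
    (hdv : ∀ T, 0 < T → IntervalIntegrable dv volume 0 T)
    (hv : ∀ t, 0 ≤ t → v t = v₀ + ∫ s in (0 : ℝ)..t, dv s) :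
    ∀ᵐ t, 0 < t → HasDerivAt v (dv t) t := by
  have h : ∀ᵐ t : ℝ, ∀ n : ℕ, t ∈ uIcc (0 : ℝ) (n + 1) → ∀ c ∈ uIcc (0 : ℝ) (n + 1),
      HasDerivAt (fun x => ∫ s in c..x, dv s) (dv t) t :=
    ae_all_iff.2 fun n => (hdv (n + 1) (by positivity)).ae_hasDerivAt_integral
  filter_upwards [h] with t ht ht0
  obtain ⟨n, hn⟩ := exists_nat_ge t
  have h1 := ht n (by rw [uIcc_of_le (by positivity)]; exact ⟨ht0.le, by linarith⟩) 0 (by simp)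
  refine (h1.const_add v₀).congr_of_eventuallyEq ?_
  filter_upwards [lt_mem_nhds ht0] with s hs using hv s hs.le

theorem le_of_ae_deriv_nonpos {G : ℝ → ℝ} {a b : ℝ} (hab : a ≤ b)
    (hG : AbsolutelyContinuousOnInterval G a b)
    (h : ∀ᵐ t, a < t → ∃ G', HasDerivAt G G' t ∧ G' ≤ 0) : G b ≤ G a := by
  have h1 := hG.integral_deriv_eq_sub
  have h2 : ∫ x in a..b, deriv G x ≤ ∫ x in a..b, (0 : ℝ) := by
    refine intervalIntegral.integral_mono_ae_restrict hab hG.intervalIntegrable_deriv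
      (by simp) ?_
    rw [← restrict_Ioc_eq_restrict_Icc]
    filter_upwards [ae_restrict_of_ae h, ae_restrict_mem measurableSet_Ioc] with t ht hm
    obtain ⟨G', hG', hle⟩ := ht hm.1
    rwa [hG'.deriv]
  simp only [intervalIntegral.integral_zero] at h2
  linarith

/-- The function `(W - b / c) exp (c t)` is nonincreasing, so the influence of the initial value
decays and the eventual bound does not depend on it. -/
theorem gronwall_limsup {W : ℝ → ℝ} {t₀ c b : ℝ} (hc : 0 < c)
    (hW : ∀ T, t₀ ≤ T → AbsolutelyContinuousOnInterval W t₀ T)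
    (h : ∀ᵐ t, t₀ < t → ∃ W', HasDerivAt W W' t ∧ W' ≤ -c * W t + b) {ε : ℝ} (hε : 0 < ε) :
    ∀ᶠ t in atTop, W t ≤ b / c + ε := by
  have key : ∀ t, t₀ ≤ t →
      (W t - b / c) * Real.exp (c * t) ≤ (W t₀ - b / c) * Real.exp (c * t₀) := by
    intro T hT
    refine le_of_ae_deriv_nonpos (G := fun t => (W t - b / c) * Real.exp (c * t)) hT ?_ ?_
    · refine AbsolutelyContinuousOnInterval.mul (f := fun t => W t - b / c)
        (g := fun t => Real.exp (c * t)) ?_ ?_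
      · exact absolutelyContinuous_of_dist_le (K := 1) (hW T hT) fun s _ t _ => by simp
      · refine ContDiffOn.absolutelyContinuousOnInterval (ContDiff.contDiffOn ?_)
        fun_prop
    · filter_upwards [h] with t ht ht0
      obtain ⟨W', hW', hle⟩ := ht ht0
      refine ⟨_, (hW'.sub_const (b / c)).mul
        (((hasDerivAt_id t).const_mul c).exp), ?_⟩
      have h1 : W' * Real.exp (c * t) + (W t - b / c) * (Real.exp (c * t) * (c * 1)) =
          (W' - (-c * W t + b)) * Real.exp (c * t) := by
        field_simp; ring
      simp only [id]
      rw [h1]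
      exact mul_nonpos_of_nonpos_of_nonneg (by linarith) (Real.exp_pos _).le
  have hlim : Tendsto (fun t => (W t₀ - b / c) * Real.exp (c * t₀) * Real.exp (-(c * t))) atTop
      (𝓝 ((W t₀ - b / c) * Real.exp (c * t₀) * 0)) :=
    (Real.tendsto_exp_neg_atTop_nhds_zero.comp
      (tendsto_id.const_mul_atTop hc)).const_mul _
  rw [mul_zero] at hlim
  filter_upwards [hlim.eventually (gt_mem_nhds hε), eventually_ge_atTop t₀] with t h1 h2
  have h3 := key t h2
  have h4 : W t - b / c ≤ (W t₀ - b / c) * Real.exp (c * t₀) * Real.exp (-(c * t)) := by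
    rw [Real.exp_neg, ← div_eq_mul_inv, le_div_iff₀ (Real.exp_pos _)]
    exact h3
  linarith

end AbsolutelyContinuous

/-! ### Trajectories and their energy inequalities -/

/-- A strong solution of one equation `∂ₜv + νAv + B(v, v) = g + P_N B(v, v)`, in differentiated
form. -/
structure Trajectory (ν N : ℝ) (g v : ℝ → L2) : Prop where
  mem_V : ∀ t, 0 ≤ t → v t ∈ V
  ac : ∀ T, 0 ≤ T → AbsolutelyContinuousOnInterval v 0 T
  deriv : ∀ᵐ t, 0 < t → v t ∈ DA ∧ HasDerivAt v (g t - ν • stokes (v t) -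
    (bilin (v t) (v t) - proj N (bilin (v t) (v t)))) t

/-! ### Low modes: orthogonal splitting and linear dynamics. -/

theorem inner_proj_high (N : ℝ) (a b : L2) : inner ℝ (proj N a) (b - proj N b) = 0 := by
  refine (hasSum_coef_mul _ _).unique ?_
  have h0 : (fun α : (Fin 2 → ℤ) × Fin 2 =>
      coef (proj N a) α.1 α.2 * coef (b - proj N b) α.1 α.2) = fun _ => 0 := by
    ext ⟨k, i⟩
    rw [coef_proj, coef_sub_proj]
    split_ifs <;> simp
  rw [h0]
  exact hasSum_zero

theorem norm_sq_proj_add (N : ℝ) (u : L2) :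
    ‖proj N u‖ ^ 2 + ‖u - proj N u‖ ^ 2 = ‖u‖ ^ 2 := by
  have h := norm_add_sq_real (proj N u) (u - proj N u)
  rw [add_sub_cancel, inner_proj_high] at h
  linarith

/-- The square of the `V`-norm of the low modes of `u`. -/
def lowEnergy (N : ℝ) (u : L2) : ℝ := ∑ α ∈ lowIdx N, ‖wave α.1‖ ^ 2 * coef u α.1 α.2 ^ 2

theorem lowEnergy_eq (N : ℝ) {u : L2} (hu : u ∈ V) : lowEnergy N u = vNorm (proj N u) ^ 2 := by
  refine HasSum.unique ?_ (hasSum_vNorm (proj_mem_V N hu))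
  have h := hasSum_sum_of_ne_finset_zero (L := .unconditional _) (s := lowIdx N)
    (f := fun α : (Fin 2 → ℤ) × Fin 2 => ‖wave α.1‖ ^ 2 * coef (proj N u) α.1 α.2 ^ 2)
    fun α hα => by
      rw [mem_lowIdx] at hα
      simp [coef_proj, hα]
  convert h using 1
  refine Finset.sum_congr rfl fun α hα => ?_
  rw [coef_proj, if_pos (mem_lowIdx.1 hα)]

theorem lowEnergy_deriv_le {ν : ℝ} (hν : 0 < ν) (N : ℝ) (u u' h : L2)
    (hu : ∀ k i, ‖wave k‖ ≤ N → coef u' k i = coef h k i - ν * (‖wave k‖ ^ 2 * coef u k i)) :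
    ∑ α ∈ lowIdx N, ‖wave α.1‖ ^ 2 * (2 * coef u α.1 α.2 * coef u' α.1 α.2) ≤
      -ν * lowEnergy N u + ‖h‖ ^ 2 / ν := by
  have h1 : ∑ α ∈ lowIdx N, coef h α.1 α.2 ^ 2 ≤ ‖h‖ ^ 2 :=
    sum_le_hasSum _ (fun _ _ => sq_nonneg _) (hasSum_coef_sq h)
  have h2 : -ν * lowEnergy N u + (∑ α ∈ lowIdx N, coef h α.1 α.2 ^ 2) / ν ≤
      -ν * lowEnergy N u + ‖h‖ ^ 2 / ν := by gcongr
  refine le_trans ?_ h2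
  rw [lowEnergy, Finset.mul_sum, Finset.sum_div, ← Finset.sum_add_distrib]
  refine Finset.sum_le_sum fun α hα => ?_
  rw [hu _ _ (mem_lowIdx.1 hα)]
  set r := ‖wave α.1‖ ^ 2 with hr
  set c := coef u α.1 α.2
  set b := coef h α.1 α.2
  -- `|k|²` is `0` or at least `1`. Completing the square leaves the dissipation `ν r² c²`, which
  -- therefore dominates the `ν r c²` needed for `lowEnergy`.
  have hr1 : r ≤ r ^ 2 := by
    by_cases h0 : α.1 = 0
    · have : r = 0 := by rw [hr, h0, norm_wave_sq]; simp
      simp [this]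
    · have : 1 ≤ r := one_le_pow₀ (one_le_norm_wave h0)
      nlinarith
  have h3 : 0 ≤ (b - ν * r * c) ^ 2 / ν := by positivity
  have h4 : (b - ν * r * c) ^ 2 / ν = b ^ 2 / ν - 2 * r * c * b + ν * r ^ 2 * c ^ 2 := by
    field_simp; ring
  have h5 : ν * c ^ 2 * r ≤ ν * c ^ 2 * r ^ 2 := mul_le_mul_of_nonneg_left hr1 (by positivity)
  linarith

theorem hasDerivAt_coef {u : ℝ → L2} {u' : L2} {t : ℝ} (h : HasDerivAt u u' t) (k i) :
    HasDerivAt (fun s => coef (u s) k i) (coef u' k i) t :=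
  ((innerSL ℝ (hartley (k, i))).hasFDerivAt.comp_hasDerivAt t h)

theorem hasDerivAt_lowEnergy (N : ℝ) {u : ℝ → L2} {u' : L2} {t : ℝ} (h : HasDerivAt u u' t) :
    HasDerivAt (fun s => lowEnergy N (u s))
      (∑ α ∈ lowIdx N, ‖wave α.1‖ ^ 2 * (2 * coef (u t) α.1 α.2 * coef u' α.1 α.2)) t := by
  unfold lowEnergy
  refine HasDerivAt.fun_sum fun α _ => ?_
  have := ((hasDerivAt_coef h α.1 α.2).pow 2).const_mul (‖wave α.1‖ ^ 2)
  refine this.congr_deriv ?_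
  simp

theorem absolutelyContinuous_lowEnergy (N : ℝ) {u : ℝ → L2} {a b : ℝ}
    (h : AbsolutelyContinuousOnInterval u a b) :
    AbsolutelyContinuousOnInterval (fun s => lowEnergy N (u s)) a b := by
  unfold lowEnergy
  induction lowIdx N using Finset.induction_on with
  | empty => exact absolutelyContinuous_of_dist_le (K := 0) h fun _ _ _ _ => by simp
  | insert α s hα ih =>
    simp only [Finset.sum_insert hα]
    refine AbsolutelyContinuousOnInterval.add
      (f := fun t => ‖wave α.1‖ ^ 2 * coef (u t) α.1 α.2 ^ 2) ?_ ih
    have h1 : AbsolutelyContinuousOnInterval (fun t => coef (u t) α.1 α.2 ^ 2) a b := by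
      simpa [coef] using absolutelyContinuous_norm_sq
        (absolutelyContinuous_clm (innerSL ℝ (hartley (α.1, α.2))) h)
    exact h1.const_mul _

/-- Asymptotic bound for the low modes, which obey linear equations with force `h`. -/
theorem eventually_lowEnergy_le {ν N t₀ B : ℝ} (hν : 0 < ν) {u h : ℝ → L2} (ht₀ : 0 ≤ t₀)
    (hac : ∀ T, 0 ≤ T → AbsolutelyContinuousOnInterval u 0 T)
    (hder : ∀ᵐ t, 0 < t → ∃ u', HasDerivAt u u' t ∧ ∀ k i, ‖wave k‖ ≤ N →
      coef u' k i = coef (h t) k i - ν * (‖wave k‖ ^ 2 * coef (u t) k i))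
    (hB : ∀ᵐ t, t₀ < t → ‖h t‖ ≤ B) {ε : ℝ} (hε : 0 < ε) :
    ∀ᶠ t in atTop, lowEnergy N (u t) ≤ B ^ 2 / ν ^ 2 + ε := by
  have := gronwall_limsup (W := fun t => lowEnergy N (u t)) (t₀ := t₀) (b := B ^ 2 / ν) hν
    (fun T hT => absolutelyContinuous_lowEnergy N ((hac T (ht₀.trans hT)).mono (by
      rw [uIcc_of_le hT, uIcc_of_le (ht₀.trans hT)]; exact Icc_subset_Icc_left ht₀)))
    (by
      filter_upwards [hder, hB] with t h1 h2 ht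
      obtain ⟨u', hu', hc⟩ := h1 (ht₀.trans_lt ht)
      refine ⟨_, hasDerivAt_lowEnergy N hu', (lowEnergy_deriv_le hν N _ _ _ hc).trans ?_⟩
      have := h2 ht
      gcongr) hε
  rwa [div_div, ← sq] at this

theorem Trajectory.coef_deriv {ν N : ℝ} {g v : L2} (hv : v ∈ DA) (k i) (hk : ‖wave k‖ ≤ N) :
    coef (g - ν • stokes v - (bilin v v - proj N (bilin v v))) k i =
      coef g k i - ν * (‖wave k‖ ^ 2 * coef v k i) := by
  rw [coef_sub, coef_sub, coef_smul, coef_stokes hv, coef_sub_proj, if_pos hk, sub_zero]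

/-! ### High modes: energy estimates for one solution and for a difference. -/

theorem DA_sub {u v : L2} (hu : u ∈ DA) (hv : v ∈ DA) : u - v ∈ DA := by
  obtain ⟨a, ha⟩ := hu.2
  obtain ⟨b, hb⟩ := hv.2
  refine ⟨sub_mem hu.1 hv.1, a - b, isWeakLaplacian_iff.2 fun k i => ?_⟩
  rw [coef_sub, coef_sub, isWeakLaplacian_iff.1 ha, isWeakLaplacian_iff.1 hb]; ring

theorem stokes_sub {u v : L2} (hu : u ∈ DA) (hv : v ∈ DA) :
    stokes (u - v) = stokes u - stokes v :=
  coef_ext fun k i => by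
    rw [coef_sub, coef_stokes (DA_sub hu hv), coef_stokes hu, coef_stokes hv, coef_sub]; ring

theorem young {a : ℝ} (ha : 0 < a) (x y : ℝ) : x * y ≤ a * x ^ 2 + y ^ 2 / (4 * a) := by
  have h : 0 ≤ (2 * a * x - y) ^ 2 / (4 * a) := by positivity
  have h2 : (2 * a * x - y) ^ 2 / (4 * a) = a * x ^ 2 - x * y + y ^ 2 / (4 * a) := by
    field_simp; ring
  linarith

theorem hasDerivAt_high (N : ℝ) {u : ℝ → L2} {u' : L2} {t : ℝ} (h : HasDerivAt u u' t) :
    HasDerivAt (fun s => ‖u s - proj N (u s)‖ ^ 2) (2 * inner ℝ u' (u t - proj N (u t))) t := by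
  have h1 := ((ContinuousLinearMap.id ℝ L2 - proj N).hasFDerivAt.comp_hasDerivAt t h).norm_sq
  refine h1.congr_deriv ?_
  change 2 * inner ℝ (u t - proj N (u t)) (u' - proj N u') = _
  rw [inner_sub_right, real_inner_comm, real_inner_comm (proj N u'), inner_proj_high, sub_zero]

theorem absolutelyContinuous_high (N : ℝ) {u : ℝ → L2} {a b : ℝ}
    (h : AbsolutelyContinuousOnInterval u a b) :
    AbsolutelyContinuousOnInterval (fun s => ‖u s - proj N (u s)‖ ^ 2) a b :=
  absolutelyContinuous_norm_sq
    (absolutelyContinuous_clm (ContinuousLinearMap.id ℝ L2 - proj N) h)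

theorem tri_le_vNorm {C : ℝ} (hC : IsLadyzhenskayaConst C) {u w : L2} (hu : u ∈ V) (hw : w ∈ V)
    (v : L2) : |tri u v w| ≤ 2 * C * vNorm u * vNorm w * vNorm v := by
  refine (tri_le hC hu hw v).trans ?_
  have := mul_le_mul_of_nonneg_right (norm4_mul_le hC hu hw) (vNorm_nonneg v)
  linarith

theorem tri_self_le {C : ℝ} (hC : IsLadyzhenskayaConst C) {u : L2} (hu : u ∈ V) (v : L2) :
    |tri u v u| ≤ 2 * C * vNorm u * ‖u‖ * vNorm v := by
  refine (tri_le hC hu hu v).trans ?_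
  have := mul_le_mul_of_nonneg_right (hC.norm4_sq_le hu) (vNorm_nonneg v)
  rw [sq] at this
  linarith

/-- Energy inequality for the high modes. -/
theorem energy_high_le {C ν N G P : ℝ} (hC : IsLadyzhenskayaConst C) (hν : 0 < ν) {g v : L2}
    (hv : v ∈ DA) (hvV : v ∈ V) (hg : ‖g‖ ≤ G) (hP : vNorm (proj N v) ≤ P)
    (hsmall : 2 * C * P ≤ max N 1 * ν / 4) :
    2 * inner ℝ (g - ν • stokes v - (bilin v v - proj N (bilin v v))) (v - proj N v) ≤
      2 * (G ^ 2 + (2 * C) ^ 2 * P ^ 4) / ν - ν / 2 * vNorm (v - proj N v) ^ 2 := by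
  set p := proj N v with hp
  set q := v - proj N v with hq
  have hpV : p ∈ V := proj_mem_V N hvV
  have hqV : q ∈ V := V_sub hvV hpV
  have hvpq : v = p + q := by rw [hp, hq, add_sub_cancel]
  have hpoin := poincare_high N hvV
  rw [← hq] at hpoin
  have hpoin1 := poincare hqV
  -- Antisymmetry removes the term with `q` differentiated, so only the controlled gradient of `p`
  -- appears.
  have htri : tri v v q = tri p p q + tri q p q := by
    have h1 : tri v v q = tri v p q := by
      conv_lhs => rw [show tri v v q = tri v (p + q) q by rw [← hvpq]]
      rw [tri_add_mid hpV hqV, tri_self hC hvV hqV, add_zero]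
    rw [h1, ← tri_add_left hC hpV hqV hqV, ← hvpq]
  have hinner : inner ℝ (g - ν • stokes v - (bilin v v - proj N (bilin v v))) q =
      inner ℝ g q - ν * vNorm q ^ 2 - (tri p p q + tri q p q) := by
    rw [inner_sub_left, inner_sub_left, inner_sub_left, real_inner_smul_left,
      inner_stokes_high N hv hvV, hq, inner_proj_high, ← hq, inner_bilin hC hv hvV hqV, htri]
    ring
  have hC0 := hC.1
  set x := vNorm q
  have hx : 0 ≤ x := vNorm_nonneg q
  have hpi : 0 ≤ vNorm p := vNorm_nonneg p
  have hP0 : 0 ≤ P := hpi.trans hP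
  have hL : 0 < max N 1 := lt_of_lt_of_le one_pos (le_max_right _ _)
  -- Each of the three terms may use a quarter of the dissipation `ν x²`; the last quarter, doubled,
  -- survives as `ν / 2`.
  have b1 : inner ℝ g q ≤ ν / 4 * x ^ 2 + G ^ 2 / ν := by
    have h1 := young (show 0 < ν / 4 by positivity) x G
    have h2 : G ^ 2 / (4 * (ν / 4)) = G ^ 2 / ν := by congr 1; ring
    have h3 : inner ℝ g q ≤ G * x := (real_inner_le_norm _ _).trans
      (mul_le_mul hg hpoin1 (norm_nonneg _) ((norm_nonneg _).trans hg))
    linarith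
  have b2 : |tri p p q| ≤ ν / 4 * x ^ 2 + (2 * C) ^ 2 * P ^ 4 / ν := by
    have h1 := young (show 0 < ν / 4 by positivity) x (2 * C * P ^ 2)
    have h2 : (2 * C * P ^ 2) ^ 2 / (4 * (ν / 4)) = (2 * C) ^ 2 * P ^ 4 / ν := by congr 1 <;> ring
    have h3 := tri_le_vNorm hC hpV hqV p
    have h4 : vNorm p * vNorm p ≤ P * P := mul_le_mul hP hP hpi hP0
    have h5 := mul_le_mul_of_nonneg_left h4 (show 0 ≤ 2 * C * x by positivity)
    have h6 : 2 * C * vNorm p * x * vNorm p = 2 * C * x * (vNorm p * vNorm p) := by ring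
    have h7 : 2 * C * x * (P * P) = x * (2 * C * P ^ 2) := by ring
    linarith
  -- This term is quadratic in `q` with no constant part; it is absorbed because `P` is small
  -- relative to `max N 1` and `|q| ≤ x / max N 1`.
  have b3 : |tri q p q| ≤ ν / 4 * x ^ 2 := by
    have h3 := tri_self_le hC hqV p
    have h4 : 2 * C * x * ‖q‖ * vNorm p ≤ 2 * C * P * (x * ‖q‖) := by
      have := mul_le_mul_of_nonneg_left hP (show 0 ≤ 2 * C * (x * ‖q‖) by positivity)
      linarith
    have h5 := mul_le_mul_of_nonneg_right hsmall (show 0 ≤ x * ‖q‖ by positivity)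
    have h6 := mul_le_mul_of_nonneg_left hpoin (show 0 ≤ ν / 4 * x by positivity)
    linarith
  rw [hinner]
  have h1 := neg_le_of_abs_le b2
  have h2 := neg_le_of_abs_le b3
  have h3 : 2 * (G ^ 2 + (2 * C) ^ 2 * P ^ 4) / ν =
    2 * (G ^ 2 / ν) + 2 * ((2 * C) ^ 2 * P ^ 4 / ν) := by ring
  rw [h3]
  linarith

/-- Energy inequality for the high modes of a difference of two solutions. -/
theorem energy_diff_le {C ν N : ℝ} (hC : IsLadyzhenskayaConst C) (hν : 0 < ν) {g₁ g₂ v₁ v₂ : L2}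
    (h₁ : v₁ ∈ DA) (h₁V : v₁ ∈ V) (h₂ : v₂ ∈ DA) (h₂V : v₂ ∈ V) :
    2 * inner ℝ ((g₁ - ν • stokes v₁ - (bilin v₁ v₁ - proj N (bilin v₁ v₁))) -
        (g₂ - ν • stokes v₂ - (bilin v₂ v₂ - proj N (bilin v₂ v₂))))
        (v₁ - v₂ - proj N (v₁ - v₂)) ≤
      -(3 / 4 * ν * max N 1 ^ 2) * ‖v₁ - v₂ - proj N (v₁ - v₂)‖ ^ 2 +
        2 * (2 * C) ^ 2 / ν * vNorm v₁ ^ 2 * ‖v₁ - v₂ - proj N (v₁ - v₂)‖ ^ 2 +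
        4 * (2 * C) ^ 2 / ν * vNorm (proj N (v₁ - v₂)) ^ 2 * (vNorm v₁ ^ 2 + vNorm v₂ ^ 2) +
        4 / ν * ‖g₁ - g₂‖ ^ 2 := by
  set w := v₁ - v₂ with hw
  set δ := proj N w with hδ
  set η := w - δ with hη
  have hwV : w ∈ V := V_sub h₁V h₂V
  have hwA : w ∈ DA := DA_sub h₁ h₂
  have hδV : δ ∈ V := proj_mem_V N hwV
  have hηV : η ∈ V := V_sub hwV hδV
  have hwδ : w = δ + η := by rw [hη, add_sub_cancel]
  have hpoin := poincare_high N hwV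
  rw [← hδ, ← hη] at hpoin
  have hpoin1 := poincare hηV
  -- Two of these terms contain the vanishing low part `δ`; only `tri η v₁ η` can make `η` grow, and
  -- it involves `v₁` alone.
  have htri : tri v₁ v₁ η - tri v₂ v₂ η = tri δ v₁ η + tri η v₁ η + tri v₂ δ η := by
    have e1 : tri v₁ v₁ η = tri w v₁ η + tri v₂ v₁ η := by
      rw [← tri_add_left hC hwV h₂V hηV, hw, sub_add_cancel]
    have e2 : tri v₂ v₁ η = tri v₂ w η + tri v₂ v₂ η := by
      rw [← tri_add_mid hwV h₂V, hw, sub_add_cancel]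
    have e3 : tri w v₁ η = tri δ v₁ η + tri η v₁ η := by
      rw [← tri_add_left hC hδV hηV hηV, ← hwδ]
    have e4 : tri v₂ w η = tri v₂ δ η := by
      conv_lhs => rw [hwδ]
      rw [tri_add_mid hδV hηV, tri_self hC h₂V hηV, add_zero]
    linarith
  have hinner : inner ℝ ((g₁ - ν • stokes v₁ - (bilin v₁ v₁ - proj N (bilin v₁ v₁))) -
        (g₂ - ν • stokes v₂ - (bilin v₂ v₂ - proj N (bilin v₂ v₂)))) η =
      inner ℝ (g₁ - g₂) η - ν * vNorm η ^ 2 - (tri δ v₁ η + tri η v₁ η + tri v₂ δ η) := by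
    have hst := inner_stokes_high N hwA hwV
    rw [hw, stokes_sub h₁ h₂, ← hw, ← hδ, ← hη, inner_sub_left] at hst
    have hb1 : inner ℝ (proj N (bilin v₁ v₁)) η = 0 := inner_proj_high N _ _
    have hb2 : inner ℝ (proj N (bilin v₂ v₂)) η = 0 := inner_proj_high N _ _
    simp only [inner_sub_left, real_inner_smul_left, hb1, hb2, inner_bilin hC h₁ h₁V hηV,
      inner_bilin hC h₂ h₂V hηV]
    linear_combination -ν * hst - htri
  rw [hinner]
  have hC0 := hC.1
  set x := vNorm η
  have hx : 0 ≤ x := vNorm_nonneg η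
  -- The four estimates use `1/8 + 1/4 + 1/8 + 1/8 = 5/8` of `ν x²`; twice the remaining `3/8` gives
  -- the rate `3/4`.
  have b0 : inner ℝ (g₁ - g₂) η ≤ ν / 8 * x ^ 2 + 2 / ν * ‖g₁ - g₂‖ ^ 2 := by
    have h1 := young (show 0 < ν / 8 by positivity) x ‖g₁ - g₂‖
    have h2 : ‖g₁ - g₂‖ ^ 2 / (4 * (ν / 8)) = 2 / ν * ‖g₁ - g₂‖ ^ 2 := by field_simp; ring
    have h3 : inner ℝ (g₁ - g₂) η ≤ ‖g₁ - g₂‖ * x := (real_inner_le_norm _ _).trans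
      (mul_le_mul_of_nonneg_left hpoin1 (norm_nonneg _))
    linarith
  have b1 : |tri η v₁ η| ≤ ν / 4 * x ^ 2 + (2 * C) ^ 2 / ν * vNorm v₁ ^ 2 * ‖η‖ ^ 2 := by
    have h1 := young (show 0 < ν / 4 by positivity) x (2 * C * ‖η‖ * vNorm v₁)
    have h2 : (2 * C * ‖η‖ * vNorm v₁) ^ 2 / (4 * (ν / 4)) =
        (2 * C) ^ 2 / ν * vNorm v₁ ^ 2 * ‖η‖ ^ 2 := by field_simp
    have h3 := tri_self_le hC hηV v₁
    linarith
  have b2 : |tri δ v₁ η| ≤ ν / 8 * x ^ 2 + 2 * (2 * C) ^ 2 / ν * vNorm δ ^ 2 * vNorm v₁ ^ 2 := by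
    have h1 := young (show 0 < ν / 8 by positivity) x (2 * C * vNorm δ * vNorm v₁)
    have h2 : (2 * C * vNorm δ * vNorm v₁) ^ 2 / (4 * (ν / 8)) =
        2 * (2 * C) ^ 2 / ν * vNorm δ ^ 2 * vNorm v₁ ^ 2 := by field_simp; ring
    have h3 := tri_le_vNorm hC hδV hηV v₁
    linarith
  have b3 : |tri v₂ δ η| ≤ ν / 8 * x ^ 2 + 2 * (2 * C) ^ 2 / ν * vNorm δ ^ 2 * vNorm v₂ ^ 2 := by
    have h1 := young (show 0 < ν / 8 by positivity) x (2 * C * vNorm δ * vNorm v₂)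
    have h2 : (2 * C * vNorm δ * vNorm v₂) ^ 2 / (4 * (ν / 8)) =
        2 * (2 * C) ^ 2 / ν * vNorm δ ^ 2 * vNorm v₂ ^ 2 := by field_simp; ring
    have h3 := tri_le_vNorm hC h₂V hηV δ
    linarith
  have b4 : max N 1 ^ 2 * ‖η‖ ^ 2 ≤ x ^ 2 := by
    rw [← mul_pow]
    exact pow_le_pow_left₀ (by positivity) hpoin 2
  have b5 := mul_le_mul_of_nonneg_left b4 (show 0 ≤ 3 / 4 * ν by positivity)
  have c1 := neg_le_of_abs_le b1
  have c2 := neg_le_of_abs_le b2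
  have c3 := neg_le_of_abs_le b3
  have e1 : 4 * (2 * C) ^ 2 / ν * vNorm δ ^ 2 * (vNorm v₁ ^ 2 + vNorm v₂ ^ 2) =
      2 * (2 * (2 * C) ^ 2 / ν * vNorm δ ^ 2 * vNorm v₁ ^ 2) +
      2 * (2 * (2 * C) ^ 2 / ν * vNorm δ ^ 2 * vNorm v₂ ^ 2) := by ring
  have e2 : 2 * (2 * C) ^ 2 / ν * vNorm v₁ ^ 2 * ‖η‖ ^ 2 =
      2 * ((2 * C) ^ 2 / ν * vNorm v₁ ^ 2 * ‖η‖ ^ 2) := by ring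
  have e3 : 4 / ν * ‖g₁ - g₂‖ ^ 2 = 2 * (2 / ν * ‖g₁ - g₂‖ ^ 2) := by ring
  rw [e1, e2, e3]
  linarith

/-! ### Synchronization -/

/-- A bound for the low modes makes the energy of the high modes dissipate. -/
theorem Trajectory.ae_high_deriv {C ν N G P t₀ : ℝ} {g v : ℝ → L2} (hT : Trajectory ν N g v)
    (hC : IsLadyzhenskayaConst C) (hν : 0 < ν) (hg : ∀ᵐ t, 0 < t → ‖g t‖ ≤ G) (ht₀ : 0 ≤ t₀)
    (hP : ∀ t, t₀ ≤ t → vNorm (proj N (v t)) ≤ P) (hsmall : 2 * C * P ≤ max N 1 * ν / 4) :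
    ∀ᵐ t, t₀ < t → ∃ y', HasDerivAt (fun s => ‖v s - proj N (v s)‖ ^ 2) y' t ∧
      y' ≤ 2 * (G ^ 2 + (2 * C) ^ 2 * P ^ 4) / ν - ν / 2 * vNorm (v t - proj N (v t)) ^ 2 := by
  filter_upwards [hT.deriv, hg] with t h1 h2 ht
  have ht' := ht₀.trans_lt ht
  obtain ⟨hA, hd⟩ := h1 ht'
  exact ⟨_, hasDerivAt_high N hd,
    energy_high_le hC hν hA (hT.mem_V t ht'.le) (h2 ht') (hP t ht.le) hsmall⟩

theorem Trajectory.ac_high {ν N t₀ : ℝ} {g v : ℝ → L2} (hT : Trajectory ν N g v) (ht₀ : 0 ≤ t₀)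
    (T : ℝ) (h : t₀ ≤ T) :
    AbsolutelyContinuousOnInterval (fun s => ‖v s - proj N (v s)‖ ^ 2) t₀ T :=
  absolutelyContinuous_high N ((hT.ac T (ht₀.trans h)).mono (by
    rw [uIcc_of_le h, uIcc_of_le (ht₀.trans h)]; exact Icc_subset_Icc_left ht₀))

/-- Only the existence of this bound matters: it enters the size of the exponential weight, but none
of the smallness conditions. -/
theorem Trajectory.eventually_high_le {C ν N G P t₀ : ℝ} {g v : ℝ → L2}
    (hT : Trajectory ν N g v)
    (hC : IsLadyzhenskayaConst C) (hν : 0 < ν) (hg : ∀ᵐ t, 0 < t → ‖g t‖ ≤ G) (ht₀ : 0 ≤ t₀)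
    (hP : ∀ t, t₀ ≤ t → vNorm (proj N (v t)) ≤ P) (hsmall : 2 * C * P ≤ max N 1 * ν / 4) :
    ∀ᶠ t in atTop, ‖v t - proj N (v t)‖ ^ 2 ≤
      2 * (G ^ 2 + (2 * C) ^ 2 * P ^ 4) / ν / (ν / 2) + 1 := by
  refine gronwall_limsup (half_pos hν) (hT.ac_high ht₀) ?_ one_pos
  filter_upwards [hT.ae_high_deriv hC hν hg ht₀ hP hsmall] with t h1 ht
  obtain ⟨y', hy, hle⟩ := h1 ht
  refine ⟨y', hy, hle.trans ?_⟩
  have htV := hT.mem_V t (ht₀.trans ht.le)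
  have h2 := poincare (V_sub htV (proj_mem_V N htV))
  have h3 := mul_le_mul_of_nonneg_left (pow_le_pow_left₀ (norm_nonneg _) h2 2) (half_pos hν).le
  linarith

theorem Trajectory.eventually_low_le {ν N G P : ℝ} {g v : ℝ → L2} (hT : Trajectory ν N g v)
    (hν : 0 < ν) (hG : 0 ≤ G) (hg : ∀ᵐ t, 0 < t → ‖g t‖ ≤ G) (hP : G / ν < P) :
    ∀ᶠ t in atTop, vNorm (proj N (v t)) ≤ P := by
  have h0 : 0 ≤ G / ν := by positivity
  have hP2 : 0 < P ^ 2 - (G / ν) ^ 2 := sub_pos.2 (pow_lt_pow_left₀ hP h0 two_ne_zero)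
  have h := eventually_lowEnergy_le (N := N) hν le_rfl hT.ac (h := g) (by
    filter_upwards [hT.deriv] with t h1 ht
    exact ⟨_, (h1 ht).2, Trajectory.coef_deriv (h1 ht).1⟩) hg hP2
  filter_upwards [h, eventually_ge_atTop 0] with t h1 h2
  rw [lowEnergy_eq N (hT.mem_V t h2)] at h1
  refine le_of_sq_le_sq ?_ (h0.trans hP.le)
  rw [div_pow] at h1
  linarith

theorem eventually_low_diff_le {ν N : ℝ} {g₁ g₂ v₁ v₂ : ℝ → L2} (hν : 0 < ν)
    (h₁ : Trajectory ν N g₁ v₁) (h₂ : Trajectory ν N g₂ v₂)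
    (hg : ∀ ε > 0, ∃ T, ∀ᵐ t, T < t → ‖g₁ t - g₂ t‖ ≤ ε) {ε : ℝ} (hε : 0 < ε) :
    ∀ᶠ t in atTop, vNorm (proj N (v₁ t - v₂ t)) ^ 2 ≤ ε := by
  -- With this force bound the asymptotic low energy is `ε / 2`; the other half of `ε` is the slack
  -- in Gronwall's lemma.
  have hB : 0 < ν * Real.sqrt (ε / 2) := by positivity
  obtain ⟨T, hT⟩ := hg _ hB
  have h := eventually_lowEnergy_le (N := N) (u := fun t => v₁ t - v₂ t)
    (h := fun t => g₁ t - g₂ t) hν (le_max_right T 0)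
    (fun T hT => (h₁.ac T hT).sub (h₂.ac T hT)) (by
      filter_upwards [h₁.deriv, h₂.deriv] with t h1 h2 ht
      refine ⟨_, (h1 ht).2.sub (h2 ht).2, fun k i hk => ?_⟩
      rw [coef_sub, Trajectory.coef_deriv (h1 ht).1 k i hk,
        Trajectory.coef_deriv (h2 ht).1 k i hk, coef_sub, coef_sub]
      ring) (B := ν * Real.sqrt (ε / 2)) (by
      filter_upwards [hT] with t h1 h2
      exact h1 (lt_of_le_of_lt (le_max_left _ _) h2)) (half_pos hε)
  filter_upwards [h, eventually_ge_atTop 0] with t h1 h2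
  rw [lowEnergy_eq N (V_sub (h₁.mem_V t h2) (h₂.mem_V t h2)), mul_pow,
    Real.sq_sqrt (by positivity), mul_div_cancel_left₀ _ (by positivity)] at h1
  linarith

/-- The differential inequality for `z exp (β y₁) + εκ (y₁ + y₂)` in terms of those for the
energies `z`, `y₁`, `y₂`. -/
theorem weighted_deriv_le {ν D P K L ε E E₁ Y z z' y₁ y₁' y₂ y₂' a b : ℝ} (hν : 0 < ν)
    (hε : 0 ≤ ε) (hL : 1 ≤ L) (hz : 0 ≤ z) (hE₁ : 0 ≤ E₁) (hE : E₁ ≤ E) (ha : 0 ≤ a) (hb : 0 ≤ b)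
    (hy₁ : y₁ ≤ Y) (hy₂ : y₂ ≤ Y) (hd₁ : y₁' ≤ K - ν / 2 * a) (hd₂ : y₂' ≤ K - ν / 2 * b)
    (hK : 2 * D ^ 2 / ν * P ^ 2 + 4 * D ^ 2 / ν ^ 2 * K ≤ ν * L ^ 2 / 4)
    (hd : z' ≤ -(3 / 4 * ν * L ^ 2) * z + 2 * D ^ 2 / ν * (P ^ 2 + a) * z +
      4 * D ^ 2 / ν * ε * (2 * P ^ 2 + a + b) + 4 / ν * ε) :
    z' * E₁ + z * (E₁ * (4 * D ^ 2 / ν ^ 2 * y₁')) +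
        ε * (8 * D ^ 2 * E / ν ^ 2) * (y₁' + y₂') ≤
      -(ν / 2) * (z * E₁ + ε * (8 * D ^ 2 * E / ν ^ 2) * (y₁ + y₂)) +
        ε * (E * (8 * D ^ 2 * P ^ 2 + 4) / ν + 2 * (8 * D ^ 2 * E / ν ^ 2) * K +
          ν * (8 * D ^ 2 * E / ν ^ 2) * Y) := by
  have hE0 : 0 ≤ E := hE₁.trans hE
  set κ := 8 * D ^ 2 * E / ν ^ 2 with hκ
  set β := 4 * D ^ 2 / ν ^ 2 with hβ
  have hκ0 : 0 ≤ κ := by positivity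
  have hβ0 : 0 ≤ β := by positivity
  -- `β` is chosen so that the dissipation in `β y₁'` cancels the growth term `2 D² / ν * a * z`,
  -- and `κ` so that the dissipation in `εκ (y₁' + y₂')` cancels the forcing `4 D² / ν * ε * (a +
  -- b)` after weighting by at most `E`.
  have hβν : β * (ν / 2) = 2 * D ^ 2 / ν := by rw [hβ]; field_simp; ring
  have hκν : κ * (ν / 2) = E * (4 * D ^ 2 / ν) := by rw [hκ]; field_simp; ring
  set F := ε * (4 * D ^ 2 / ν * (2 * P ^ 2 + a + b) + 4 / ν) with hF
  have hF0 : 0 ≤ F := by positivity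
  -- By `hK` the remaining growth uses at most `ν L² / 4` of the rate `3 ν L² / 4`, and `L ≥ 1`
  -- turns what is left into `ν / 2`.
  have s1 : z' + z * (β * y₁') ≤ -(ν / 2) * z + F := by
    have h1 : z * β * y₁' ≤ z * β * (K - ν / 2 * a) :=
      mul_le_mul_of_nonneg_left hd₁ (by positivity)
    have h2 := mul_le_mul_of_nonneg_left hK hz
    have h3 : ν * z * 1 ≤ ν * z * L ^ 2 :=
      mul_le_mul_of_nonneg_left (one_le_pow₀ hL) (by positivity)
    have h4 : z * β * (K - ν / 2 * a) = z * (β * K) - 2 * D ^ 2 / ν * a * z := by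
      rw [← hβν]; ring
    nlinarith
  have s2 := mul_le_mul_of_nonneg_right s1 hE₁
  have s3 : F * E₁ ≤ F * E := mul_le_mul_of_nonneg_left hE hF0
  have s4 : ε * κ * (y₁' + y₂') ≤ ε * κ * (2 * K - ν / 2 * (a + b)) :=
    mul_le_mul_of_nonneg_left (by linarith) (by positivity)
  have s5 : ε * κ * (y₁ + y₂) * (ν / 2) ≤ ε * κ * (2 * Y) * (ν / 2) := by
    gcongr; linarith
  have s6 : F * E = ε * (κ * (ν / 2)) * (a + b) + ε * (E * (8 * D ^ 2 * P ^ 2 + 4) / ν) := by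
    rw [hκν, hF]; ring
  nlinarith

theorem synchronization {C ν N G : ℝ} {g₁ g₂ v₁ v₂ : ℝ → L2} (hC : IsLadyzhenskayaConst C)
    (hν : 0 < ν) (hG : 0 ≤ G) (h₁ : Trajectory ν N g₁ v₁) (h₂ : Trajectory ν N g₂ v₂)
    (hg₁ : ∀ᵐ t, 0 < t → ‖g₁ t‖ ≤ G) (hg₂ : ∀ᵐ t, 0 < t → ‖g₂ t‖ ≤ G)
    (hg : ∀ ε > 0, ∃ T, ∀ᵐ t, T < t → ‖g₁ t - g₂ t‖ ≤ ε)
    (hsmall : 2 * C * (G / ν) < max N 1 * ν / 4)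
    (hK : 2 * (2 * C) ^ 2 / ν * (G / ν) ^ 2 + 4 * (2 * C) ^ 2 / ν ^ 2 *
      (2 * (G ^ 2 + (2 * C) ^ 2 * (G / ν) ^ 4) / ν) < ν * max N 1 ^ 2 / 4) :
    Tendsto (fun t => ‖v₁ t - v₂ t‖) atTop (𝓝 0) := by
  -- The low modes only come below levels strictly above `G / ν`; the strict hypotheses leave room
  -- for such a `P` by continuity.
  obtain ⟨P, hGP, hsmall, hK⟩ : ∃ P, G / ν < P ∧ 2 * C * P ≤ max N 1 * ν / 4 ∧
      2 * (2 * C) ^ 2 / ν * P ^ 2 + 4 * (2 * C) ^ 2 / ν ^ 2 *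
        (2 * (G ^ 2 + (2 * C) ^ 2 * P ^ 4) / ν) ≤ ν * max N 1 ^ 2 / 4 := by
    have c1 : Continuous fun P : ℝ => 2 * C * P := by fun_prop
    have c2 : Continuous fun P : ℝ => 2 * (2 * C) ^ 2 / ν * P ^ 2 + 4 * (2 * C) ^ 2 / ν ^ 2 *
        (2 * (G ^ 2 + (2 * C) ^ 2 * P ^ 4) / ν) := by fun_prop
    have e1 := (c1.tendsto (G / ν)).eventually (gt_mem_nhds hsmall)
    have e2 := (c2.tendsto (G / ν)).eventually (gt_mem_nhds hK)
    obtain ⟨P, ⟨h1, h2⟩, h3⟩ := (((e1.and e2).filter_mono nhdsWithin_le_nhds).and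
      (self_mem_nhdsWithin (s := Ioi (G / ν)))).exists
    exact ⟨P, h3, h1.le, h2.le⟩
  set K := 2 * (G ^ 2 + (2 * C) ^ 2 * P ^ 4) / ν with hKdef
  have hP0 : 0 ≤ P := le_trans (by positivity) hGP.le
  have hK0 : 0 ≤ K := by positivity
  obtain ⟨t₀, ht₀⟩ := eventually_atTop.1 ((h₁.eventually_low_le hν hG hg₁ hGP).and
    ((h₂.eventually_low_le hν hG hg₂ hGP).and (eventually_ge_atTop (0 : ℝ))))
  have h0 : 0 ≤ t₀ := (ht₀ t₀ le_rfl).2.2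
  have hP₁ : ∀ t, t₀ ≤ t → vNorm (proj N (v₁ t)) ≤ P := fun t ht => (ht₀ t ht).1
  have hP₂ : ∀ t, t₀ ≤ t → vNorm (proj N (v₂ t)) ≤ P := fun t ht => (ht₀ t ht).2.1
  set Y := K / (ν / 2) + 1 with hY
  have hY₁ := h₁.eventually_high_le hC hν hg₁ h0 hP₁ hsmall
  have hY₂ := h₂.eventually_high_le hC hν hg₂ h0 hP₂ hsmall
  set β := 4 * (2 * C) ^ 2 / ν ^ 2 with hβ
  have hβ0 : 0 ≤ β := by positivity
  set E := Real.exp (β * Y) with hE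
  set κ := 8 * (2 * C) ^ 2 * E / ν ^ 2 with hκ
  have hκ0 : 0 ≤ κ := by positivity
  set R := E * (8 * (2 * C) ^ 2 * P ^ 2 + 4) / ν + 2 * κ * K + ν * κ * Y with hR
  have hY0 : 0 ≤ Y := by positivity
  have hR0 : 0 ≤ R := by positivity
  set y₁ : ℝ → ℝ := fun t => ‖v₁ t - proj N (v₁ t)‖ ^ 2 with hy₁
  set y₂ : ℝ → ℝ := fun t => ‖v₂ t - proj N (v₂ t)‖ ^ 2 with hy₂
  set z : ℝ → ℝ := fun t => ‖v₁ t - v₂ t - proj N (v₁ t - v₂ t)‖ ^ 2 with hz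
  -- `R` does not depend on `ε`. The `2` collects the low-mode part of the difference and the slack
  -- in Gronwall's lemma.
  have main : ∀ ε > 0, ∀ᶠ t in atTop, ‖v₁ t - v₂ t‖ ^ 2 ≤ ε * (R / (ν / 2) + 2) := by
    intro ε hε
    have hδ := eventually_low_diff_le hν h₁ h₂ hg hε
    obtain ⟨T, hT⟩ := hg (Real.sqrt ε) (by positivity)
    obtain ⟨t₁, ht₁⟩ := eventually_atTop.1 (hδ.and (hY₁.and (hY₂.and
      ((eventually_ge_atTop t₀).and (eventually_ge_atTop T)))))
    have h01 : t₀ ≤ t₁ := (ht₁ t₁ le_rfl).2.2.2.1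
    have hT1 : T ≤ t₁ := (ht₁ t₁ le_rfl).2.2.2.2
    have h0t : 0 ≤ t₁ := h0.trans h01
    have hW := gronwall_limsup
      (W := fun t => z t * Real.exp (β * y₁ t) + ε * κ * (y₁ t + y₂ t)) (t₀ := t₁)
      (b := ε * R) (half_pos hν) (fun T hT => ?_) ?_ hε
    · filter_upwards [hW, hδ, eventually_ge_atTop 0] with t hWt hδt ht
      have hw := V_sub (h₁.mem_V t ht) (h₂.mem_V t ht)
      have e1 := norm_sq_proj_add N (v₁ t - v₂ t)
      have e2 := pow_le_pow_left₀ (norm_nonneg _) (poincare (proj_mem_V N hw)) 2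
      -- The weight is at least `1`, so a bound for the functional bounds `z` itself.
      have e3 : z t * 1 ≤ z t * Real.exp (β * y₁ t) :=
        mul_le_mul_of_nonneg_left (Real.one_le_exp (by positivity)) (by positivity)
      have e4 : 0 ≤ ε * κ * (y₁ t + y₂ t) := by positivity
      have e5 : ε * (R / (ν / 2) + 2) = ε * R / (ν / 2) + ε + ε := by ring
      have e6 : z t = ‖v₁ t - v₂ t - proj N (v₁ t - v₂ t)‖ ^ 2 := rfl
      linarith
    · have a1 := h₁.ac_high h0t T hT
      have a2 := h₂.ac_high h0t T hT
      have a3 : AbsolutelyContinuousOnInterval z t₁ T :=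
        absolutelyContinuous_high N (u := fun t => v₁ t - v₂ t)
          (((h₁.ac T (h0t.trans hT)).sub (h₂.ac T (h0t.trans hT))).mono (by
            rw [uIcc_of_le hT, uIcc_of_le (h0t.trans hT)]; exact Icc_subset_Icc_left h0t))
      have a4 := absolutelyContinuous_comp_contDiff (φ := fun y => Real.exp (β * y))
        (by fun_prop) a1
      exact (a3.mul a4).add ((a1.add a2).const_mul (ε * κ))
    · filter_upwards [h₁.ae_high_deriv hC hν hg₁ h0 hP₁ hsmall,
        h₂.ae_high_deriv hC hν hg₂ h0 hP₂ hsmall, h₁.deriv, h₂.deriv, hT]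
        with t k1 k2 k3 k4 k5 ht
      have ht0 : t₀ < t := h01.trans_lt ht
      have htp : 0 < t := h0.trans_lt ht0
      obtain ⟨hδt, hYt₁, hYt₂, -, -⟩ := ht₁ t ht.le
      obtain ⟨y₁', hd₁, hle₁⟩ := k1 ht0
      obtain ⟨y₂', hd₂, hle₂⟩ := k2 ht0
      obtain ⟨hA₁, hv₁⟩ := k3 htp
      obtain ⟨hA₂, hv₂⟩ := k4 htp
      have hV₁ := h₁.mem_V t htp.le
      have hV₂ := h₂.mem_V t htp.le
      have hzd := hasDerivAt_high N (hv₁.sub hv₂)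
      have hzle := energy_diff_le (N := N) (g₁ := g₁ t) (g₂ := g₂ t) hC hν hA₁ hV₁ hA₂ hV₂
      refine ⟨_, (hzd.mul (hd₁.const_mul β).exp).add ((hd₁.add hd₂).const_mul (ε * κ)), ?_⟩
      have hg2 : ‖g₁ t - g₂ t‖ ^ 2 ≤ ε := by
        have := pow_le_pow_left₀ (norm_nonneg _) (k5 (hT1.trans_lt ht)) 2
        rwa [Real.sq_sqrt hε.le] at this
      have hexp : Real.exp (β * y₁ t) ≤ E :=
        Real.exp_le_exp.2 (mul_le_mul_of_nonneg_left hYt₁ hβ0)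
      have hp₁ : vNorm (v₁ t) ^ 2 ≤ P ^ 2 + vNorm (v₁ t - proj N (v₁ t)) ^ 2 := by
        rw [← vNorm_sq_add N hV₁]
        have := pow_le_pow_left₀ (vNorm_nonneg _) (hP₁ t ht0.le) 2
        linarith
      have hp₂ : vNorm (v₂ t) ^ 2 ≤ P ^ 2 + vNorm (v₂ t - proj N (v₂ t)) ^ 2 := by
        rw [← vNorm_sq_add N hV₂]
        have := pow_le_pow_left₀ (vNorm_nonneg _) (hP₂ t ht0.le) 2
        linarith
      refine weighted_deriv_le (z := z t) hν hε.le (le_max_right N 1) (sq_nonneg _)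
        (Real.exp_pos _).le hexp (sq_nonneg _) (sq_nonneg _) hYt₁ hYt₂ hle₁ hle₂ hK ?_
      refine hzle.trans ?_
      have m1 : 2 * (2 * C) ^ 2 / ν * vNorm (v₁ t) ^ 2 * z t ≤
          2 * (2 * C) ^ 2 / ν * (P ^ 2 + vNorm (v₁ t - proj N (v₁ t)) ^ 2) * z t := by
        gcongr
      have m2 : 4 * (2 * C) ^ 2 / ν * vNorm (proj N (v₁ t - v₂ t)) ^ 2 *
          (vNorm (v₁ t) ^ 2 + vNorm (v₂ t) ^ 2) ≤ 4 * (2 * C) ^ 2 / ν * ε *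
          (2 * P ^ 2 + vNorm (v₁ t - proj N (v₁ t)) ^ 2 +
            vNorm (v₂ t - proj N (v₂ t)) ^ 2) := by
        refine mul_le_mul (by gcongr) (by linarith) (by positivity) (by positivity)
      have m3 : 4 / ν * ‖g₁ t - g₂ t‖ ^ 2 ≤ 4 / ν * ε := by gcongr
      have m4 : z t = ‖v₁ t - v₂ t - proj N (v₁ t - v₂ t)‖ ^ 2 := rfl
      linarith
  rw [Metric.tendsto_atTop']
  intro ε hε
  have hpos : 0 < R / (ν / 2) + 2 := by positivity
  obtain ⟨T, hT⟩ := eventually_atTop.1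
    (main (ε ^ 2 / 2 / (R / (ν / 2) + 2)) (by positivity))
  refine ⟨T, fun t ht => ?_⟩
  have h := hT t (le_of_lt ht)
  rw [div_mul_cancel₀ _ hpos.ne'] at h
  rw [Real.dist_eq, sub_zero, abs_of_nonneg (norm_nonneg _)]
  refine lt_of_pow_lt_pow_left₀ 2 hε.le (h.trans_lt ?_)
  linarith [pow_pos hε 2]

/-! ### From strong solutions to trajectories, and the condition on `N`. -/

theorem IsIntertwinedSolution.trajectory {ν N : ℝ} {g : Fin 2 → ℝ → L2} {v₀ : Fin 2 → L2}
    {v : Fin 2 → ℝ → L2}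
    (hv : IsIntertwinedSolution ν 1 (fun _ v => proj N (bilin v v)) g v₀ v) (i : Fin 2) :
    Trajectory ν N (g i) (v i) := by
  obtain ⟨dv, hdv, hint, heq⟩ := hv.equation
  have hii : ∀ T, 0 < T → IntervalIntegrable (dv i) volume 0 T := fun T hT => by
    rw [intervalIntegrable_iff_integrableOn_Ioc_of_le hT.le]
    exact (hdv i T hT).integrable (by norm_num)
  refine ⟨hv.mem_V i, fun T hT => ?_, ?_⟩
  · rcases hT.eq_or_lt with rfl | hT'
    · exact absolutelyContinuous_primitive le_rfl (by simp) (hint i)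
    · exact absolutelyContinuous_primitive hT (hii T hT') (hint i)
  · have h1 := (ae_restrict_iff' measurableSet_Ioi).1 (hv.mem_DA i)
    have h2 := (ae_restrict_iff' measurableSet_Ioi).1 (heq i)
    filter_upwards [ae_hasDerivAt_primitive hii (hint i), h1, h2] with t k1 k2 k3 ht
    refine ⟨k2 ht, ?_⟩
    have h3 := k3 ht
    have h4 : ∑ j, (1 : Matrix (Fin 2) (Fin 2) ℝ) i j • proj N (bilin (v j t) (v j t)) =
        proj N (bilin (v i t) (v i t)) := by
      simp [Matrix.one_apply]
    rw [h4] at h3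
    have h5 : g i t - ν • stokes (v i t) -
        (bilin (v i t) (v i t) - proj N (bilin (v i t) (v i t))) = dv i t := by
      rw [eq_sub_of_add_eq h3.symm]; abel
    rw [h5]
    exact k1 ht

theorem IsForce.ae_norm_le {g : ℝ → L2} (hg : IsForce g) :
    ∀ᵐ t, 0 < t → ‖g t‖ ≤ supNorm g := by
  have h := ae_le_eLpNormEssSup (f := g) (μ := volume.restrict (Ioi (0 : ℝ)))
  rw [ae_restrict_iff' measurableSet_Ioi] at h
  filter_upwards [h] with t ht h0
  have h1 := ENNReal.toReal_mono (by
    rw [← eLpNorm_exponent_top]; exact hg.1.2.ne) (ht h0)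
  rwa [toReal_enorm, ← eLpNorm_exponent_top] at h1

theorem grashof_nonneg {ν : ℝ} (g : Fin 2 → ℝ → L2) : 0 ≤ grashof ν g :=
  le_max_of_le_left (div_nonneg ENNReal.toReal_nonneg (sq_nonneg ν))

/-- With `G = ν² γ` all powers of `ν` scale out of the second smallness condition of
`synchronization`, which becomes exactly this one. The first becomes `8 C γ < max N 1` and is
weaker, since `64 ≤ 160`. -/
theorem degenerateSelfSynchronous_of_small {C ν N : ℝ} {g : Fin 2 → ℝ → L2}
    (hC : IsLadyzhenskayaConst C) (hν : 0 < ν) (hg : ∀ i, IsForce (g i))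
    (hs : 160 * (C * grashof ν g) ^ 2 + 512 * (C * grashof ν g) ^ 4 < max N 1 ^ 2) :
    DegenerateSelfSynchronous ν N g := by
  intro hlim v₀ _ v hv
  set γ := grashof ν g with hγ
  have hν2 : 0 < ν ^ 2 := by positivity
  have hγ0 : 0 ≤ γ := grashof_nonneg g
  have hb : ∀ i, ∀ᵐ t, 0 < t → ‖g i t‖ ≤ ν ^ 2 * γ := fun i => by
    have hle : supNorm (g i) ≤ ν ^ 2 * γ := by
      rw [← div_le_iff₀' hν2]
      fin_cases i
      · exact le_max_left _ _
      · exact le_max_right _ _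
    filter_upwards [(hg i).ae_norm_le] with t ht h0 using (ht h0).trans hle
  have hC0 := hC.1.le
  have hL : 0 < max N 1 := lt_of_lt_of_le one_pos (le_max_right _ _)
  refine synchronization hC hν (G := ν ^ 2 * γ) (by positivity) (hv.trajectory 0)
    (hv.trajectory 1) (hb 0) (hb 1) (fun ε hε => ?_) ?_ ?_
  · obtain ⟨s, hs, t, ht, hst⟩ := mem_inf_iff_superset.1 (hlim.eventually (gt_mem_nhds hε))
    obtain ⟨T, hT⟩ := mem_atTop_sets.1 hs
    refine ⟨T, ?_⟩
    filter_upwards [ht] with x hx hTx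
    exact le_of_lt (hst ⟨hT x hTx.le, hx⟩)
  · have h1 : 8 * (C * γ) < max N 1 := by
      refine lt_of_pow_lt_pow_left₀ 2 hL.le ?_
      have h2 : 0 ≤ (C * γ) ^ 4 := by positivity
      nlinarith [sq_nonneg (C * γ)]
    have h2 : 2 * C * (ν ^ 2 * γ / ν) = 8 * (C * γ) * ν / 4 := by field_simp; ring
    rw [h2]
    gcongr
  · have h2 : 2 * (2 * C) ^ 2 / ν * (ν ^ 2 * γ / ν) ^ 2 + 4 * (2 * C) ^ 2 / ν ^ 2 *
        (2 * ((ν ^ 2 * γ) ^ 2 + (2 * C) ^ 2 * (ν ^ 2 * γ / ν) ^ 4) / ν) =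
        ν * (160 * (C * γ) ^ 2 + 512 * (C * γ) ^ 4) / 4 := by
      field_simp; ring
    rw [h2]
    gcongr

end TorusNSE

end

theorem mainTheorem2 (ν : ℝ) (hν : 0 < ν) (g : Fin 2 → ℝ → TorusNSE.L2)
    (hg : ∀ i, TorusNSE.IsForce (g i)) :
    (∃ N₀ : ℝ, 0 < N₀ ∧ ∀ N : ℝ, N₀ ≤ N → TorusNSE.DegenerateSelfSynchronous ν N g) ∧
    (∀ CL CS : ℝ, TorusNSE.IsLadyzhenskayaConst CL → TorusNSE.IsBorderlineSobolevConst CS →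
      ∀ N : ℝ, 0 < N →
        max (9 * Real.sqrt 3 / CL) (12 * Real.sqrt 2 * CL) * TorusNSE.grashof ν g ≤ N →
        32 * Real.sqrt 2 * CL *
            Real.sqrt (24 * (CL ^ 2 + CS ^ 2 * Real.log N) * TorusNSE.grashof ν g ^ 2 + 1) *
            TorusNSE.grashof ν g ≤ N →
        TorusNSE.DegenerateSelfSynchronous ν N g) := by
  have hγ : 0 ≤ TorusNSE.grashof ν g := TorusNSE.grashof_nonneg g
  set γ := TorusNSE.grashof ν g with hγdef
  constructor
  · set X := 160 * (3 * γ) ^ 2 + 512 * (3 * γ) ^ 4 with hX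
    have hX0 : 0 ≤ X := by positivity
    refine ⟨1 + X, by positivity, fun N hN =>
      TorusNSE.degenerateSelfSynchronous_of_small TorusNSE.isLadyzhenskayaConst_three hν hg ?_⟩
    calc X < (1 + X) ^ 2 := by nlinarith
      _ ≤ max N 1 ^ 2 := by
        gcongr
        exact hN.trans (le_max_left _ _)
  · intro CL CS hCL _ N hN h1 h2
    refine TorusNSE.degenerateSelfSynchronous_of_small hCL hν hg ?_
    rw [← hγdef]
    have hC0 := hCL.1
    set s := (CL * γ) ^ 2 with hs
    have hs0 : 0 ≤ s := sq_nonneg _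
    have hs4 : (CL * γ) ^ 4 = s ^ 2 := by rw [hs]; ring
    rw [hs4]
    -- For `N < 1` the bound `12√2 CL γ ≤ N` gives `288 s < 1`, and `160/288 + 512/288² < 1`.
    rcases lt_or_ge N 1 with hN1 | hN1
    · have h3 : 12 * Real.sqrt 2 * CL * γ ≤ N :=
        (mul_le_mul_of_nonneg_right (le_max_right _ _) hγ).trans h1
      have h4 := pow_le_pow_left₀ (by positivity) h3 2
      have h5 : (12 * Real.sqrt 2 * CL * γ) ^ 2 = 288 * s := by
        rw [show (12 * Real.sqrt 2 * CL * γ) ^ 2 = 144 * Real.sqrt 2 ^ 2 * (CL * γ) ^ 2 by ring,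
          Real.sq_sqrt (by norm_num)]
        ring
      have h6 : s ≤ 1 / 288 := by nlinarith
      rw [max_eq_right hN1.le]
      nlinarith
    · have hlog : 0 ≤ Real.log N := Real.log_nonneg hN1
      -- For `N ≥ 1` the logarithmic contribution is nonnegative, so squaring yields `2048 s + 49152
      -- s² ≤ N²`, more than required.
      have h3 := pow_le_pow_left₀ (by positivity) h2 2
      have hr : 0 ≤ 24 * (CL ^ 2 + CS ^ 2 * Real.log N) * γ ^ 2 + 1 := by positivity
      have h5 : (32 * Real.sqrt 2 * CL *
          Real.sqrt (24 * (CL ^ 2 + CS ^ 2 * Real.log N) * γ ^ 2 + 1) * γ) ^ 2 =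
          2048 * s * (24 * s + 1) + 49152 * s * (CS ^ 2 * Real.log N * γ ^ 2) := by
        rw [show (32 * Real.sqrt 2 * CL *
            Real.sqrt (24 * (CL ^ 2 + CS ^ 2 * Real.log N) * γ ^ 2 + 1) * γ) ^ 2 =
            1024 * Real.sqrt 2 ^ 2 * (CL * γ) ^ 2 *
            Real.sqrt (24 * (CL ^ 2 + CS ^ 2 * Real.log N) * γ ^ 2 + 1) ^ 2 by ring,
          Real.sq_sqrt (by norm_num), Real.sq_sqrt hr, hs]
        ring
      have h6 : 0 ≤ 49152 * s * (CS ^ 2 * Real.log N * γ ^ 2) := by positivity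
      rw [max_eq_left hN1]
      nlinarith
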